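/- Let $M$ be a smooth manifold (Hausdorff, second countable, without boundary; neither connectedness nor orientability is needed), and let $Z\subseteq M$ be a closed hypersurface for which there are an open neighbourhood $U$ of $Z$ and a smooth function $f\colon U\to\mathbb R$ with $Z=f^{-1}(0)$ and $\mathrm df_q\neq 0$ for all $q\in Z$; that is, $(M,Z)$ is a $b$-manifold. The $b$-tangent bundle ${}^b\mathrm TM$ is the smooth vector bundle over $M$ whose sheaf of sections is the locally free sheaf of smooth vector fields on $M$ that are tangent to $Z$; it is obtained by gluing trivial bundles along the transition matrices of the local frames of this sheaf. The inclusion of this sheaf into the sheaf of all vector fields induces the anchor $\rho\colon {}^b\mathrm TM\to \mathrm TM$, which is an isomorphism over $M\setminus Z$. The associated graph $G_{M,Z}$ has the connected components of $M\setminus Z$ as nodes and the connected components of $Z$ as edges. A node $M_\alpha$ belongs to an edge $Z_\gamma$ if and only if $\overline{M_\alpha}\cap Z_\gamma\neq\emptyset$. The edge $Z_\gamma$ has ends $a,b$ if $a$ and $b$ are precisely the nodes belonging to it; it is a loop if only one node belongs to it. Multiple edges are allowed. The graph is two-colorable if there is a map $c$ from the nodes to $\{+1,-1\}$ with $c(a)\neq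 c(b)$ whenever $a,b$ are the two ends of an edge; in particular, a graph with a loop is not two-colorable. Then: 1. $G_{M,Z}$ is a (multi)graph: exactly one or two nodes belong to each edge. 2. If there is an isomorphism of smooth vector bundles ${}^b\mathrm TM\cong \mathrm TM$ over the identity of $M$, then $G_{M,Z}$ is two-colorable. 3. More precisely, for every isomorphism of smooth vector bundles $\Phi\colon \mathrm TM\to{}^b\mathrm TM$ over the identity of $M$ there is a two-coloring $c$ of $G_{M,Z}$ that is given by the sign of the determinant of the local gauge transformations $\rho_p\circ\Phi_p\colon \mathrm T_pM\to \mathrm T_pM$: for all $p\in M\setminus Z$, if $[p]$ denotes the component of $M\setminus Z$ that contains $p$, then $c([p])=\operatorname{sign}\det(\rho_p\circ\Phi_p)$. -/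

import Mathlib

open Set Filter Topology Bundle MeasureTheory
open scoped Manifold ContDiff

set_option linter.unusedSectionVars false

theorem contDiff_unitIntegral {P : Type*} [NormedAddCommGroup P] [NormedSpace ℝ P]
    {K : P × ℝ → ℝ} (hK : ContDiff ℝ ∞ K) :
    ContDiff ℝ ∞ (fun p => ∫ t in (0:ℝ)..1, K (p, t)) := by
  let η : ContDiffBump (0 : ℝ) := ⟨1, 2, by norm_num, by norm_num⟩
  have key := contDiffOn_convolution_right_with_param_comp (n := ⊤) (μ := volume)
    (ContinuousLinearMap.mul ℝ ℝ) (s := (univ : Set P)) (v := fun _ => (0:ℝ)) contDiffOn_const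
    (f := indicator (Ioc (0:ℝ) 1) (fun _ => (1:ℝ)))
    (g := fun p s => η s * K (p, -s)) (k := Metric.closedBall 0 2) isOpen_univ
    (isCompact_closedBall _ _) ?_ ?_ ?_
  · rw [contDiffOn_univ] at key
    convert key using 2 with p
    rw [intervalIntegral.integral_of_le zero_le_one, ← integral_indicator measurableSet_Ioc]
    unfold convolution
    congr 1 with t
    by_cases ht : t ∈ Ioc (0:ℝ) 1
    · have : η (-t) = 1 := η.one_of_mem_closedBall (by
        simp [abs_le]; constructor <;> linarith [ht.1, ht.2])
      simp [ht, this]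
    · simp [ht]
  · intro p x _ hx
    have : η x = 0 := η.zero_of_le_dist (by
      simp only [Metric.mem_closedBall, not_le] at hx; exact hx.le)
    simp [this]
  · exact (integrable_indicator_iff measurableSet_Ioc |>.2 (by simp)).locallyIntegrable
  · apply ContDiff.contDiffOn
    have h1 : ContDiff ℝ ∞ (fun x : P × ℝ => η x.2) := η.contDiff.comp contDiff_snd
    exact h1.mul (hK.comp (contDiff_fst.prodMk contDiff_snd.neg))

theorem hadamard_linear {E : Type*} [NormedAddCommGroup E] [NormedSpace ℝ E]
    {G : E → ℝ} (hG : ContDiff ℝ ∞ G) (ℓ : E →L[ℝ] ℝ) (v : E) (hv : ℓ v = 1)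
    (h0 : ∀ y, ℓ y = 0 → G y = 0) :
    ∃ H : E → ℝ, ContDiff ℝ ∞ H ∧ ∀ y, G y = ℓ y * H y := by
  let c : E × ℝ → E := fun q => q.1 + ((q.2 - 1) * ℓ q.1) • v
  have hc : ContDiff ℝ ∞ c := by
    have : ContDiff ℝ ∞ (fun q : E × ℝ => ℓ q.1) := ℓ.contDiff.comp contDiff_fst
    exact contDiff_fst.add (((contDiff_snd.sub contDiff_const).mul this).smul contDiff_const)
  have hdG : ContDiff ℝ ∞ (fderiv ℝ G) := hG.fderiv_right (by simp)
  have hK : ContDiff ℝ ∞ (fun q : E × ℝ => fderiv ℝ G (c q) v) :=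
    (hdG.comp hc).clm_apply contDiff_const
  refine ⟨_, contDiff_unitIntegral hK, fun y => ?_⟩
  have hder : ∀ t : ℝ, HasDerivAt (fun t => G (c (y, t))) (ℓ y * fderiv ℝ G (c (y, t)) v) t := by
    intro t
    have h1 : HasDerivAt (fun t => c (y, t)) (ℓ y • v) t := by
      have : HasDerivAt (fun t : ℝ => (t - 1) * ℓ y) (1 * ℓ y) t :=
        ((hasDerivAt_id t).sub_const 1).mul_const _
      simpa [c] using (this.smul_const v).const_add y
    have h2 := ((hG.differentiable (by simp)) (c (y, t))).hasFDerivAt.comp_hasDerivAt t h1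
    refine HasDerivAt.congr_deriv (f := fun t => G (c (y, t))) h2 ?_
    simp
  have hcont : Continuous (fun t => fderiv ℝ G (c (y, t)) v) :=
    hK.continuous.comp (Continuous.prodMk_right y)
  have := intervalIntegral.integral_eq_sub_of_hasDerivAt (a := 0) (b := 1) (fun t _ => hder t)
    ((continuous_const.mul hcont).intervalIntegrable _ _)
  rw [intervalIntegral.integral_const_mul] at this
  have e0 : G (c (y, 0)) = 0 := h0 _ (by simp [c, hv])
  have e1 : c (y, 1) = y := by simp [c]
  rw [e0, e1, sub_zero] at this
  exact this.symm

theorem hadamard_local {E : Type*} [NormedAddCommGroup E] [NormedSpace ℝ E]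
    [FiniteDimensional ℝ E] {f g : E → ℝ} {W : Set E} (hW : IsOpen W) {x : E} (hx : x ∈ W)
    (hf : ContDiffOn ℝ ∞ f W) (hg : ContDiffOn ℝ ∞ g W)
    (hdf : fderiv ℝ f x ≠ 0) (h0 : ∀ y ∈ W, f y = 0 → g y = 0) :
    ∃ (W' : Set E) (h : E → ℝ), IsOpen W' ∧ x ∈ W' ∧ W' ⊆ W ∧ ContDiffOn ℝ ∞ h W' ∧
      ∀ y ∈ W', g y = f y * h y := by
  set ℓ := fderiv ℝ f x with hℓ
  obtain ⟨w, hw⟩ : ∃ w, ℓ w ≠ 0 := by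
    by_contra! hcon; exact hdf (ContinuousLinearMap.ext hcon)
  let v := (ℓ w)⁻¹ • w
  have hv : ℓ v = 1 := by simp [v, hw]
  let Ψ : E → E := fun y => y + (f y - ℓ y) • v
  have hℓΨ : ∀ y, ℓ (Ψ y) = f y := fun y => by simp [Ψ, hv]
  have hΨ : ContDiffOn ℝ ∞ Ψ W :=
    contDiffOn_id.add ((hf.sub ℓ.contDiff.contDiffOn).smul contDiffOn_const)
  have hΨx : ContDiffAt ℝ ∞ Ψ x := hΨ.contDiffAt (hW.mem_nhds hx)
  have hd : HasFDerivAt Ψ (ContinuousLinearEquiv.refl ℝ E : E →L[ℝ] E) x := by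
    have h1 : HasFDerivAt f ℓ x :=
      ((hf.contDiffAt (hW.mem_nhds hx)).differentiableAt (by simp)).hasFDerivAt
    have h2 := (hasFDerivAt_id x).add ((h1.sub ℓ.hasFDerivAt).smul_const v)
    refine h2.congr_fderiv ?_
    ext y; simp
  let e := hΨx.toOpenPartialHomeomorph Ψ hd (by simp)
  have hxe : x ∈ e.source := hΨx.mem_toOpenPartialHomeomorph_source hd (by simp)
  have heΨ : ∀ y, e y = Ψ y := fun y => rfl
  -- points at which the derivative is invertible
  have hcd : ContinuousOn (fderiv ℝ Ψ) W := hΨ.continuousOn_fderiv_of_isOpen hW (by simp)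
  let R : Set E := W ∩ fderiv ℝ Ψ ⁻¹' range ((↑) : (E ≃L[ℝ] E) → E →L[ℝ] E)
  have hRo : IsOpen R := hcd.isOpen_inter_preimage hW ContinuousLinearEquiv.isOpen
  have hxR : x ∈ R := ⟨hx, ⟨_, hd.fderiv.symm⟩⟩
  let T : Set E := e.target ∩ e.symm ⁻¹' R
  have hTo : IsOpen T := e.symm.isOpen_inter_preimage hRo
  have hxT : e x ∈ T := ⟨e.map_source hxe, by simpa [e.left_inv hxe] using hxR⟩
  have hsymm : ContDiffOn ℝ ∞ e.symm T := by
    intro y hy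
    obtain ⟨A, hA⟩ := hy.2.2
    have hdiff : HasFDerivAt e (A : E →L[ℝ] E) (e.symm y) := by
      rw [hA]
      exact ((hΨ.contDiffAt (hW.mem_nhds hy.2.1)).differentiableAt (by simp)).hasFDerivAt
    exact (e.contDiffAt_symm hy.1 hdiff (hΨ.contDiffAt (hW.mem_nhds hy.2.1))).contDiffWithinAt
  obtain ⟨r, hr, hrT⟩ := Metric.isOpen_iff.1 hTo _ hxT
  let χ : ContDiffBump (e x) := ⟨r / 3, r / 2, by positivity, by linarith⟩
  let G : E → ℝ := fun y => χ y * g (e.symm y)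
  have hGs : ContDiff ℝ ∞ G := by
    rw [contDiff_iff_contDiffAt]
    intro y
    by_cases hy : y ∈ T
    · refine χ.contDiff.contDiffAt.mul ?_
      have : ContDiffOn ℝ ∞ (fun y => g (e.symm y)) T :=
        hg.comp hsymm (fun z hz => hz.2.1)
      exact this.contDiffAt (hTo.mem_nhds hy)
    · have : y ∉ tsupport χ := by
        rw [χ.tsupport_eq]
        intro h
        exact hy (hrT (Metric.closedBall_subset_ball (by change r / 2 < r; linarith) h))
      have h1 : ∀ᶠ z in 𝓝 y, z ∉ tsupport χ :=
        (isClosed_tsupport _).isOpen_compl.mem_nhds this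
      refine (contDiffAt_const (c := (0:ℝ))).congr_of_eventuallyEq ?_
      filter_upwards [h1] with z hz
      simp [G, image_eq_zero_of_notMem_tsupport hz]
  obtain ⟨H, hH, hGH⟩ := hadamard_linear hGs ℓ v hv (by
    intro y hy
    by_cases hyT : y ∈ T
    · have : f (e.symm y) = 0 := by
        rw [← hℓΨ, ← heΨ, e.right_inv hyT.1, hy]
      simp [G, h0 _ hyT.2.1 this]
    · have : χ y = 0 := χ.zero_of_le_dist (by
        by_contra! hcon
        exact hyT (hrT (Metric.mem_ball.2 (hcon.trans (by change r / 2 < r; linarith)))))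
      simp [G, this])
  refine ⟨(e.source ∩ e ⁻¹' Metric.ball (e x) (r / 3)) ∩ W, fun y => H (Ψ y),
    (e.isOpen_inter_preimage Metric.isOpen_ball).inter hW, ⟨⟨hxe, ?_⟩, hx⟩, inter_subset_right,
    hH.comp_contDiffOn (hΨ.mono inter_subset_right), ?_⟩
  · exact Metric.mem_ball_self (by positivity)
  · rintro y ⟨⟨hy1, hy2⟩, -⟩
    have := hGH (e y)
    rw [heΨ, hℓΨ] at this
    rw [← this]
    have h1 : χ (e y) = 1 := χ.one_of_mem_closedBall (Metric.ball_subset_closedBall hy2)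
    simp only [G]
    rw [← heΨ, h1, e.left_inv hy1, one_mul]

theorem hadamard_manifold {n : ℕ} {M : Type*} [TopologicalSpace M]
    [ChartedSpace (EuclideanSpace ℝ (Fin n)) M] [IsManifold (𝓡 n) ∞ M]
    {f g : M → ℝ} {W : Set M} (hW : IsOpen W) {p : M} (hp : p ∈ W)
    (hf : ContMDiffOn (𝓡 n) 𝓘(ℝ) ∞ f W) (hg : ContMDiffOn (𝓡 n) 𝓘(ℝ) ∞ g W)
    (hdf : mvfderiv (𝓡 n) f p ≠ 0) (h0 : ∀ q ∈ W, f q = 0 → g q = 0) :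
    ∃ (W' : Set M) (h : M → ℝ), IsOpen W' ∧ p ∈ W' ∧ W' ⊆ W ∧
      ContMDiffOn (𝓡 n) 𝓘(ℝ) ∞ h W' ∧ ∀ q ∈ W', g q = f q * h q := by
  let φ := extChartAt (𝓡 n) p
  let T : Set (EuclideanSpace ℝ (Fin n)) := φ.target ∩ φ.symm ⁻¹' W
  have hTo : IsOpen T :=
    (continuousOn_extChartAt_symm p).isOpen_inter_preimage (isOpen_extChartAt_target p) hW
  have hsymm : ContMDiffOn 𝓘(ℝ, EuclideanSpace ℝ (Fin n)) (𝓡 n) ∞ φ.symm T :=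
    (contMDiffOn_extChartAt_symm p).mono inter_subset_left
  have hF : ∀ u : M → ℝ, ContMDiffOn (𝓡 n) 𝓘(ℝ) ∞ u W → ContDiffOn ℝ ∞ (u ∘ φ.symm) T :=
    fun u hu => contMDiffOn_iff_contDiffOn.1 (hu.comp hsymm (fun y hy => hy.2))
  have hd : fderiv ℝ (f ∘ φ.symm) (φ p) ≠ 0 := by
    have hmd : MDifferentiableAt (𝓡 n) 𝓘(ℝ) f p :=
      (hf.contMDiffAt (hW.mem_nhds hp)).mdifferentiableAt (by simp)
    intro hcon
    apply hdf
    rw [hmd.mvfderiv]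
    simp only [writtenInExtChartAt, extChartAt_model_space_eq_id, PartialEquiv.refl_coe,
      Function.id_comp]
    have : range (𝓡 n) = univ := by simp
    rw [this, fderivWithin_univ]
    exact hcon
  obtain ⟨T', h, hT'o, hpT', hT'T, hh, heq⟩ := hadamard_local hTo
    (x := φ p) ⟨mem_extChartAt_target p, by
      simpa [φ] using hp⟩ (hF f hf) (hF g hg) hd (fun y hy h => h0 _ hy.2 h)
  refine ⟨φ.source ∩ φ ⁻¹' T' ∩ W, h ∘ φ,
    ((continuousOn_extChartAt p).isOpen_inter_preimage (isOpen_extChartAt_source p) hT'o).inter hW,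
    ⟨⟨mem_extChartAt_source p, hpT'⟩, hp⟩, inter_subset_right, ?_, ?_⟩
  · refine (contMDiffOn_iff_contDiffOn.2 hh).comp (t := T') ?_ (fun q hq => hq.1.2)
    refine (contMDiffOn_extChartAt (n := ∞) (I := 𝓡 n) (x := p)).mono ?_
    intro q hq
    simpa [φ, extChartAt_source] using hq.1.1
  · intro q hq
    have := heq (φ q) hq.1.2
    simpa [φ.left_inv hq.1.1] using this

theorem mvfderiv_congr_of_eventuallyEq {n : ℕ} {M : Type*} [TopologicalSpace M]
    [ChartedSpace (EuclideanSpace ℝ (Fin n)) M] {f g : M → ℝ} {p : M} (h : f =ᶠ[𝓝 p] g) :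
    mvfderiv (𝓡 n) f p = mvfderiv (𝓡 n) g p := by
  ext v
  change (mfderiv (𝓡 n) 𝓘(ℝ) f p : EuclideanSpace ℝ (Fin n) →L[ℝ] ℝ) v =
    (mfderiv (𝓡 n) 𝓘(ℝ) g p : EuclideanSpace ℝ (Fin n) →L[ℝ] ℝ) v
  exact congrArg (fun L : EuclideanSpace ℝ (Fin n) →L[ℝ] ℝ => L v) h.mfderiv_eq

/-- The differential of `f` along a smooth vector field is smooth. -/
theorem contMDiffOn_mvfderiv_apply {n : ℕ} {M : Type*} [TopologicalSpace M]
    [ChartedSpace (EuclideanSpace ℝ (Fin n)) M] [IsManifold (𝓡 n) ∞ M]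
    {f : M → ℝ} {V : Set M} (hV : IsOpen V) (hf : ContMDiffOn (𝓡 n) 𝓘(ℝ) ∞ f V)
    {X : Π p : M, TangentSpace (𝓡 n) p}
    (hX : ContMDiffOn (𝓡 n) (𝓡 n).tangent ∞ (fun p => (⟨p, X p⟩ : TangentBundle (𝓡 n) M)) V) :
    ContMDiffOn (𝓡 n) 𝓘(ℝ) ∞ (fun p => mvfderiv (𝓡 n) f p (X p)) V := by
  have h1 := hf.contMDiffOn_tangentMapWithin (m := ∞) (n := ∞) (by simp) hV.uniqueMDiffOn
  have h2 := h1.comp hX (fun p hp => hp)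
  have h3 := (contMDiff_snd_tangentBundle_modelSpace ℝ 𝓘(ℝ) (n := ∞)).comp_contMDiffOn h2
  refine h3.congr fun p hp => ?_
  change (mfderiv (𝓡 n) 𝓘(ℝ) f p : EuclideanSpace ℝ (Fin n) →L[ℝ] ℝ) (X p) =
    (mfderivWithin (𝓡 n) 𝓘(ℝ) f V p : EuclideanSpace ℝ (Fin n) →L[ℝ] ℝ) (X p)
  rw [mfderivWithin_of_isOpen hV hp]

section BManifold

variable (n : ℕ) (M : Type*) [TopologicalSpace M] [ChartedSpace (EuclideanSpace ℝ (Fin n)) M]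
  [IsManifold (𝓡 n) ∞ M]

/-- A `b`-manifold structure on `M`: a closed hypersurface `Z`, cut out transversally by a smooth
function `f` that is defined on an open neighbourhood `U` of `Z`. -/
structure BManifold where
  Z : Set M
  isClosed : IsClosed Z
  exists_defining : ∃ (U : Set M) (f : M → ℝ), IsOpen U ∧ Z ⊆ U ∧
    ContMDiffOn (𝓡 n) 𝓘(ℝ) ∞ f U ∧ (∀ q ∈ U, f q = 0 ↔ q ∈ Z) ∧
    ∀ q ∈ Z, mvfderiv (𝓡 n) f q ≠ 0

variable {n M}

/-- `v ∈ T_pM` is tangent to `Z` at `p`: it annihilates every smooth function near `p` that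
vanishes on `Z`. -/
def IsTangentTo (Z : Set M) (p : M) (v : TangentSpace (𝓡 n) p) : Prop :=
  ∀ (W : Set M) (g : M → ℝ), IsOpen W → p ∈ W → ContMDiffOn (𝓡 n) 𝓘(ℝ) ∞ g W →
    (∀ q ∈ W ∩ Z, g q = 0) → mvfderiv (𝓡 n) g p v = 0

/-- `X` is smooth on the set `V`, as a section of `TM`. -/
def IsSmoothVF (V : Set M) (X : Π p : M, TangentSpace (𝓡 n) p) : Prop :=
  ContMDiffOn (𝓡 n) (𝓡 n).tangent ∞ (fun p => (⟨p, X p⟩ : TangentBundle (𝓡 n) M)) V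

namespace BManifold

variable (B : BManifold n M)

/-- Sections over `V` of the sheaf of vector fields tangent to `Z` (extended arbitrarily
to all of `M`). -/
def IsBVectorField (V : Set M) (X : Π p : M, TangentSpace (𝓡 n) p) : Prop :=
  IsSmoothVF V X ∧ ∀ p ∈ V ∩ B.Z, IsTangentTo B.Z p (X p)

/-- A local frame of the sheaf of vector fields tangent to `Z`, over an open set `baseSet`: over
every open `V ⊆ baseSet`, the fields `e i` freely generate the module of sections. -/
structure Frame where
  baseSet : Set M
  isOpen : IsOpen baseSet
  e : Fin n → Π p : M, TangentSpace (𝓡 n) p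
  isBVectorField : ∀ i, B.IsBVectorField baseSet (e i)
  generates : ∀ V ⊆ baseSet, IsOpen V → ∀ X, B.IsBVectorField V X →
    ∃ c : Fin n → M → ℝ, (∀ i, ContMDiffOn (𝓡 n) 𝓘(ℝ) ∞ (c i) V) ∧
      ∀ p ∈ V, X p = ∑ i, c i p • e i p
  independent : ∀ V ⊆ baseSet, IsOpen V → ∀ c : Fin n → M → ℝ,
    (∀ i, ContMDiffOn (𝓡 n) 𝓘(ℝ) ∞ (c i) V) → (∀ p ∈ V, ∑ i, c i p • e i p = 0) →
      ∀ i, ∀ p ∈ V, c i p = 0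

theorem dense_compl : Dense B.Zᶜ := by
  obtain ⟨U, f, hU, hZU, hf, hfZ, hdf⟩ := B.exists_defining
  rw [← interior_eq_empty_iff_dense_compl, Set.eq_empty_iff_forall_notMem]
  intro q hq
  apply hdf q (interior_subset hq)
  have : f =ᶠ[𝓝 q] fun _ => (0 : ℝ) := by
    filter_upwards [isOpen_interior.mem_nhds hq] with x hx
    exact (hfZ x (hZU (interior_subset hx))).2 (interior_subset hx)
  rw [mvfderiv_congr_of_eventuallyEq this, mvfderiv_const]

/-- Division by a defining function. -/
theorem exists_div {U : Set M} {f : M → ℝ}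
    (hf : ContMDiffOn (𝓡 n) 𝓘(ℝ) ∞ f U) (hfZ : ∀ q ∈ U, f q = 0 ↔ q ∈ B.Z)
    (hdf : ∀ q ∈ B.Z, mvfderiv (𝓡 n) f q ≠ 0) {V : Set M} (hV : IsOpen V) (hVU : V ⊆ U)
    {g : M → ℝ} (hg : ContMDiffOn (𝓡 n) 𝓘(ℝ) ∞ g V) (hgZ : ∀ q ∈ V ∩ B.Z, g q = 0) :
    ∃ h : M → ℝ, ContMDiffOn (𝓡 n) 𝓘(ℝ) ∞ h V ∧ ∀ q ∈ V, g q = f q * h q := by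
  have hloc : ∀ p ∈ V, ∃ (W : Set M) (h : M → ℝ), IsOpen W ∧ p ∈ W ∧ W ⊆ V ∧
      ContMDiffOn (𝓡 n) 𝓘(ℝ) ∞ h W ∧ ∀ q ∈ W, g q = f q * h q := by
    intro p hp
    by_cases hpZ : p ∈ B.Z
    · exact hadamard_manifold hV hp (hf.mono hVU) hg (hdf p hpZ)
        (fun q hq h => hgZ q ⟨hq, (hfZ q (hVU hq)).1 h⟩)
    · have hne : ∀ q ∈ V ∩ B.Zᶜ, f q ≠ 0 := fun q hq h => hq.2 ((hfZ q (hVU hq.1)).1 h)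
      refine ⟨V ∩ B.Zᶜ, fun q => g q / f q, hV.inter B.isClosed.isOpen_compl, ⟨hp, hpZ⟩,
        inter_subset_left, ?_, fun q hq => ?_⟩
      · exact (hg.mono inter_subset_left).div₀ (hf.mono (inter_subset_left.trans hVU)) hne
      · have := hne q hq
        field_simp
  let h := extendFrom B.Zᶜ (fun q => g q / f q)
  have key : ∀ (W : Set M) (h' : M → ℝ), IsOpen W → W ⊆ V →
      ContMDiffOn (𝓡 n) 𝓘(ℝ) ∞ h' W → (∀ q ∈ W, g q = f q * h' q) → ∀ q ∈ W, h q = h' q := by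
    intro W h' hW hWV hh' heq q hq
    refine extendFrom_eq (B.dense_compl q) ?_
    have h1 : Tendsto h' (𝓝[B.Zᶜ] q) (𝓝 (h' q)) :=
      ((hh'.continuousOn.continuousAt (hW.mem_nhds hq)).tendsto).mono_left nhdsWithin_le_nhds
    refine h1.congr' ?_
    filter_upwards [self_mem_nhdsWithin, nhdsWithin_le_nhds (hW.mem_nhds hq)] with x hxZ hxW
    have : f x ≠ 0 := fun h => hxZ ((hfZ x (hVU (hWV hxW))).1 h)
    rw [heq x hxW]
    field_simp
  refine ⟨h, fun p hp => ?_, fun p hp => ?_⟩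
  · obtain ⟨W, h', hW, hpW, hWV, hh', heq⟩ := hloc p hp
    refine ContMDiffAt.contMDiffWithinAt ?_
    refine (hh'.contMDiffAt (hW.mem_nhds hpW)).congr_of_eventuallyEq ?_
    filter_upwards [hW.mem_nhds hpW] with x hx
    exact key W h' hW hWV hh' heq x hx
  · obtain ⟨W, h', hW, hpW, hWV, hh', heq⟩ := hloc p hp
    rw [key W h' hW hWV hh' heq p hpW, heq p hpW]

theorem isTangentTo_of_mvfderiv_eq_zero {U : Set M} {f : M → ℝ} (hU : IsOpen U)
    (hf : ContMDiffOn (𝓡 n) 𝓘(ℝ) ∞ f U) (hfZ : ∀ q ∈ U, f q = 0 ↔ q ∈ B.Z)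
    (hdf : ∀ q ∈ B.Z, mvfderiv (𝓡 n) f q ≠ 0) {p : M} (hpU : p ∈ U) (hp : p ∈ B.Z)
    {v : TangentSpace (𝓡 n) p} (hv : mvfderiv (𝓡 n) f p v = 0) : IsTangentTo B.Z p v := by
  intro W g hW hpW hg hgZ
  obtain ⟨h, hh, heq⟩ := B.exists_div hf hfZ hdf (hU.inter hW) inter_subset_left
    (hg.mono inter_subset_right) (fun q hq => hgZ q ⟨hq.1.2, hq.2⟩)
  have hmem := (hU.inter hW).mem_nhds ⟨hpU, hpW⟩
  have hev : g =ᶠ[𝓝 p] f * h := by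
    filter_upwards [hmem] with x hx
    exact heq x hx
  have hf' : MDifferentiableAt (𝓡 n) 𝓘(ℝ) f p :=
    (hf.contMDiffAt (hU.mem_nhds hpU)).mdifferentiableAt (by simp)
  have hh' : MDifferentiableAt (𝓡 n) 𝓘(ℝ) h p :=
    (hh.contMDiffAt hmem).mdifferentiableAt (by simp)
  rw [mvfderiv_congr_of_eventuallyEq hev, mvfderiv_mul hf' hh']
  have : f p = 0 := (hfZ p hpU).2 hp
  simp [this, hv]

theorem exists_frame_of_notMem {p : M} (hp : p ∉ B.Z) : ∃ i : B.Frame, p ∈ i.baseSet := by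
  let t := trivializationAt (EuclideanSpace ℝ (Fin n)) (TangentSpace (𝓡 n)) p
  let b := (EuclideanSpace.basisFun (Fin n) ℝ).toBasis
  have hpt : p ∈ t.baseSet := mem_baseSet_trivializationAt _ _ p
  have hloc := t.isLocalFrameOn_localFrame_baseSet (𝓡 n) ∞ b
  refine ⟨⟨t.baseSet ∩ B.Zᶜ, t.open_baseSet.inter B.isClosed.isOpen_compl, t.localFrame b,
    fun i => ⟨(hloc.contMDiffOn i).mono inter_subset_left, fun q hq => absurd hq.2 hq.1.2⟩, ?_, ?_⟩,
    hpt, hp⟩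
  · intro V hVA hV X hX
    exact ⟨fun i q => t.localFrameCoeff (𝓡 n) b i q (X q),
      (contMDiffOn_iff_localFrameCoeff (e := t) b hV (hVA.trans inter_subset_left)).1 hX.1,
      fun q hq => t.eq_sum_localFrameCoeff_smul (b := b) (I := 𝓡 n) (s := X) (hVA hq).1⟩
  · intro V hVA hV c hc h0 i q hq
    exact Fintype.linearIndependent_iff.1 (hloc.linearIndependent (hVA hq).1) _ (h0 q hq) i

theorem exists_frame_of_mem {p : M} (hp : p ∈ B.Z) : ∃ i : B.Frame, p ∈ i.baseSet := by
  obtain ⟨U, f, hU, hZU, hf, hfZ, hdf⟩ := B.exists_defining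
  let t := trivializationAt (EuclideanSpace ℝ (Fin n)) (TangentSpace (𝓡 n)) p
  let b := (EuclideanSpace.basisFun (Fin n) ℝ).toBasis
  have hpt : p ∈ t.baseSet := mem_baseSet_trivializationAt _ _ p
  have hloc := t.isLocalFrameOn_localFrame_baseSet (𝓡 n) ∞ b
  let s := t.localFrame b
  let a : Fin n → M → ℝ := fun i q => mvfderiv (𝓡 n) f q (s i q)
  have ha : ∀ i, ContMDiffOn (𝓡 n) 𝓘(ℝ) ∞ (a i) (t.baseSet ∩ U) := fun i =>
    contMDiffOn_mvfderiv_apply (t.open_baseSet.inter hU) (hf.mono inter_subset_right)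
      ((hloc.contMDiffOn i).mono inter_subset_left)
  obtain ⟨k, hk⟩ : ∃ k, a k p ≠ 0 := by
    by_contra! hcon
    apply hdf p hp
    ext v
    have : v ∈ Submodule.span ℝ (range (s · p)) := hloc.generating hpt trivial
    induction this using Submodule.span_induction with
    | mem x hx => obtain ⟨i, rfl⟩ := hx; exact hcon i
    | zero => simp
    | add x y _ _ hx hy => rw [map_add, hx, hy]; simp
    | smul c x _ hx => rw [map_smul, hx]; simp
  let A : Set M := (t.baseSet ∩ U) ∩ a k ⁻¹' {0}ᶜ
  have hA : IsOpen A := (ha k).continuousOn.isOpen_inter_preimage (t.open_baseSet.inter hU)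
    isOpen_compl_singleton
  have hAt : A ⊆ t.baseSet := fun q hq => hq.1.1
  have hAU : A ⊆ U := fun q hq => hq.1.2
  have hak : ∀ q ∈ A, a k q ≠ 0 := fun q hq => hq.2
  let e : Fin n → Π q : M, TangentSpace (𝓡 n) q := fun i q =>
    if i = k then f q • s k q else s i q - (a i q / a k q) • s k q
  have hs : ∀ i, IsSmoothVF A (s i) := fun i => (hloc.contMDiffOn i).mono hAt
  have he : ∀ i, IsSmoothVF A (e i) := by
    intro i
    by_cases hik : i = k
    · simp only [e, hik, if_true]
      exact (hf.mono hAU).smul_section (hs k)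
    · simp only [e, hik, if_false]
      exact (hs i).sub_section ((((ha i).mono inter_subset_left).div₀
        ((ha k).mono inter_subset_left) hak).smul_section (hs k))
  -- the sum of the `e i` with coefficients `c`, in terms of the coordinate frame
  have hsum : ∀ (c : Fin n → ℝ) (q : M), ∑ i, c i • e i q = ∑ i, (if i = k then
      c k * f q - ∑ j ∈ Finset.univ.erase k, c j * (a j q / a k q) else c i) • s i q := by
    intro c q
    rw [← Finset.add_sum_erase _ _ (Finset.mem_univ k),
      ← Finset.add_sum_erase _ _ (Finset.mem_univ k)]
    have h1 : ∑ i ∈ Finset.univ.erase k, c i • e i q =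
        ∑ i ∈ Finset.univ.erase k, c i • s i q -
          (∑ j ∈ Finset.univ.erase k, c j * (a j q / a k q)) • s k q := by
      rw [Finset.sum_smul, ← Finset.sum_sub_distrib]
      refine Finset.sum_congr rfl fun i hi => ?_
      have := Finset.ne_of_mem_erase hi
      simp only [e, this, if_false, smul_sub, smul_smul]
    have h2 : ∑ i ∈ Finset.univ.erase k, (if i = k then
        c k * f q - ∑ j ∈ Finset.univ.erase k, c j * (a j q / a k q) else c i) • s i q =
        ∑ i ∈ Finset.univ.erase k, c i • s i q :=
      Finset.sum_congr rfl fun i hi => by simp [Finset.ne_of_mem_erase hi]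
    rw [h1, h2]
    simp only [e, if_true, smul_smul, sub_smul]
    abel
  refine ⟨⟨A, hA, e, fun i => ⟨he i, fun q hq => ?_⟩, ?_, ?_⟩, ⟨⟨hpt, hZU hp⟩, hk⟩⟩
  · refine B.isTangentTo_of_mvfderiv_eq_zero hU hf hfZ hdf (hAU hq.1) hq.2 ?_
    by_cases hik : i = k
    · simp [e, hik, (hfZ q (hAU hq.1)).2 hq.2]
    · have := hak q hq.1
      simp only [e, hik, if_false, map_sub, map_smul, smul_eq_mul]
      change a i q - a i q / a k q * a k q = 0
      field_simp
      simp
  · intro V hVA hV X hX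
    have hx := (contMDiffOn_iff_localFrameCoeff (e := t) (k := ∞) b hV (hVA.trans hAt)).1 hX.1
    let x : Fin n → M → ℝ := fun i q => t.localFrameCoeff (𝓡 n) b i q (X q)
    have hXs : ∀ q ∈ V, X q = ∑ i, x i q • s i q :=
      fun q hq => t.eq_sum_localFrameCoeff_smul (b := b) (I := 𝓡 n) (s := X) (hAt (hVA hq))
    have hdX : ContMDiffOn (𝓡 n) 𝓘(ℝ) ∞ (fun q => mvfderiv (𝓡 n) f q (X q) / a k q) V :=
      (contMDiffOn_mvfderiv_apply hV (hf.mono (hVA.trans hAU)) hX.1).div₀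
        ((ha k).mono (hVA.trans inter_subset_left)) (fun q hq => hak q (hVA hq))
    obtain ⟨h, hh, heq⟩ := B.exists_div hf hfZ hdf hV (hVA.trans hAU) hdX (fun q hq => by
      have := hX.2 q hq U f hU (hAU (hVA hq.1)) hf (fun y hy => (hfZ y hy.1).2 hy.2)
      simp [this])
    refine ⟨fun i => if i = k then h else x i, fun i => ?_, fun q hq => ?_⟩
    · by_cases hik : i = k
      · simpa [hik] using hh
      · simpa [hik] using hx i
    · have hq' := hak q (hVA hq)
      have h3 : mvfderiv (𝓡 n) f q (X q) = ∑ i, x i q * a i q := by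
        rw [hXs q hq, map_sum]
        simp [a]
      have h4 := heq q hq
      rw [h3, ← Finset.add_sum_erase _ _ (Finset.mem_univ k), add_div,
        mul_div_cancel_right₀ _ hq'] at h4
      rw [hXs q hq, hsum (fun i => (if i = k then h else x i) q)]
      refine Finset.sum_congr rfl fun i _ => ?_
      congr 1
      by_cases hik : i = k
      · subst hik
        simp only [if_true]
        rw [mul_comm (h q), ← h4, Finset.sum_div, add_sub_assoc, eq_comm, add_eq_left,
          sub_eq_zero]
        refine Finset.sum_congr rfl fun j hj => ?_
        rw [if_neg (Finset.ne_of_mem_erase hj), mul_div_assoc]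
      · simp [hik]
  · intro V hVA hV c hc h0
    have hlin : ∀ q ∈ V, ∀ i, (if i = k then c k q * f q -
        ∑ j ∈ Finset.univ.erase k, c j q * (a j q / a k q) else c i q) = 0 := by
      intro q hq
      have := h0 q hq
      rw [hsum (fun i => c i q)] at this
      exact Fintype.linearIndependent_iff.1 (hloc.linearIndependent (hAt (hVA hq))) _ this
    have hne : ∀ i, i ≠ k → ∀ q ∈ V, c i q = 0 := fun i hik q hq => by
      simpa [hik] using hlin q hq i
    have hkf : ∀ q ∈ V, c k q * f q = 0 := fun q hq => by
      have := hlin q hq k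
      rw [if_pos rfl, Finset.sum_eq_zero, sub_zero] at this
      · exact this
      · intro j hj
        rw [hne j (Finset.ne_of_mem_erase hj) q hq, zero_mul]
    intro i q hq
    by_cases hik : i = k
    · subst hik
      by_contra hcon
      have hev : ∀ᶠ y in 𝓝 q, c i y ≠ 0 ∧ y ∈ V :=
        (((hc i).continuousOn.continuousAt (hV.mem_nhds hq)).eventually_ne hcon).and
          (hV.mem_nhds hq)
      obtain ⟨y, hy3, hy1, hy2⟩ := (B.dense_compl.inter_nhds_nonempty hev)
      exact hy3 ((hfZ y (hAU (hVA hy2))).1 ((mul_eq_zero.1 (hkf y hy2)).resolve_left hy1))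
    · exact hne i hik q hq

/-- The sheaf of vector fields tangent to `Z` is locally free. -/
theorem exists_frame (p : M) : ∃ i : B.Frame, p ∈ i.baseSet := by
  by_cases hp : p ∈ B.Z
  · exact B.exists_frame_of_mem hp
  · exact B.exists_frame_of_notMem hp

/-- The coefficients expressing the `a`-th field of the frame `i` through the frame `j`. -/
noncomputable def coeff (i j : B.Frame) (a : Fin n) : Fin n → M → ℝ :=
  (j.generates (i.baseSet ∩ j.baseSet) inter_subset_right (i.isOpen.inter j.isOpen) (i.e a)
    ⟨(i.isBVectorField a).1.mono inter_subset_left,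
      fun p hp => (i.isBVectorField a).2 p ⟨hp.1.1, hp.2⟩⟩).choose

theorem contMDiffOn_coeff (i j : B.Frame) (a b : Fin n) :
    ContMDiffOn (𝓡 n) 𝓘(ℝ) ∞ (B.coeff i j a b) (i.baseSet ∩ j.baseSet) :=
  (j.generates (i.baseSet ∩ j.baseSet) inter_subset_right (i.isOpen.inter j.isOpen) (i.e a)
    ⟨(i.isBVectorField a).1.mono inter_subset_left,
      fun p hp => (i.isBVectorField a).2 p ⟨hp.1.1, hp.2⟩⟩).choose_spec.1 b

theorem sum_coeff (i j : B.Frame) (a : Fin n) {p : M} (hp : p ∈ i.baseSet ∩ j.baseSet) :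
    i.e a p = ∑ b, B.coeff i j a b p • j.e b p :=
  (j.generates (i.baseSet ∩ j.baseSet) inter_subset_right (i.isOpen.inter j.isOpen) (i.e a)
    ⟨(i.isBVectorField a).1.mono inter_subset_left,
      fun p hp => (i.isBVectorField a).2 p ⟨hp.1.1, hp.2⟩⟩).choose_spec.2 p hp

theorem coeff_self (i : B.Frame) (a b : Fin n) {p : M} (hp : p ∈ i.baseSet) :
    B.coeff i i a b p = if a = b then 1 else 0 := by
  rw [← sub_eq_zero]
  refine i.independent i.baseSet subset_rfl i.isOpen
    (fun b q => B.coeff i i a b q - if a = b then 1 else 0) (fun b => ?_) (fun q hq => ?_) b p hp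
  · have := B.contMDiffOn_coeff i i a b
    rw [inter_self] at this
    exact this.sub contMDiffOn_const
  · simp only [sub_smul, Finset.sum_sub_distrib]
    rw [← B.sum_coeff i i a ⟨hq, hq⟩]
    simp

theorem coeff_comp (i j k : B.Frame) (a c : Fin n) {p : M}
    (hp : p ∈ i.baseSet ∩ j.baseSet ∩ k.baseSet) :
    ∑ b, B.coeff i j a b p * B.coeff j k b c p = B.coeff i k a c p := by
  rw [← sub_eq_zero]
  refine k.independent (i.baseSet ∩ j.baseSet ∩ k.baseSet) inter_subset_right
    ((i.isOpen.inter j.isOpen).inter k.isOpen)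
    (fun c q => ∑ b, B.coeff i j a b q * B.coeff j k b c q - B.coeff i k a c q)
    (fun c => ?_) (fun q hq => ?_) c p hp
  · refine ContMDiffOn.sub (contMDiffOn_finsetSum fun b _ => ?_) ?_
    · exact ((B.contMDiffOn_coeff i j a b).mono inter_subset_left).mul
        ((B.contMDiffOn_coeff j k b c).mono fun q hq => ⟨hq.1.2, hq.2⟩)
    · exact (B.contMDiffOn_coeff i k a c).mono fun q hq => ⟨hq.1.1, hq.2⟩
  · simp only [sub_smul, Finset.sum_sub_distrib, Finset.sum_smul]
    rw [← B.sum_coeff i k a ⟨hq.1.1, hq.2⟩, Finset.sum_comm, sub_eq_zero,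
      B.sum_coeff i j a hq.1]
    refine Finset.sum_congr rfl fun b _ => ?_
    rw [B.sum_coeff j k b ⟨hq.1.2, hq.2⟩, Finset.smul_sum]
    simp only [smul_smul]

/-- The transition matrix from the frame `i` to the frame `j`. -/
noncomputable def transition (i j : B.Frame) (p : M) :
    EuclideanSpace ℝ (Fin n) →L[ℝ] EuclideanSpace ℝ (Fin n) :=
  ∑ a, ∑ b, B.coeff i j a b p •
    (EuclideanSpace.proj a : EuclideanSpace ℝ (Fin n) →L[ℝ] ℝ).smulRight
      (EuclideanSpace.single b (1 : ℝ))

theorem transition_apply (i j : B.Frame) (p : M) (v : EuclideanSpace ℝ (Fin n)) (b : Fin n) :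
    B.transition i j p v b = ∑ a, v a * B.coeff i j a b p := by
  simp [transition, Finset.sum_apply, Pi.single_apply, mul_comm]

theorem contMDiffOn_transition (i j : B.Frame) :
    ContMDiffOn (𝓡 n) 𝓘(ℝ, EuclideanSpace ℝ (Fin n) →L[ℝ] EuclideanSpace ℝ (Fin n)) ∞
      (B.transition i j) (i.baseSet ∩ j.baseSet) :=
  contMDiffOn_finsetSum fun a _ => contMDiffOn_finsetSum fun b _ =>
    (B.contMDiffOn_coeff i j a b).smul contMDiffOn_const

/-- The vector bundle obtained by gluing trivial bundles over the domains of all local frames of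
the sheaf of vector fields tangent to `Z`, along the transition matrices of these frames. -/
noncomputable def core : VectorBundleCore ℝ M (EuclideanSpace ℝ (Fin n)) B.Frame where
  baseSet i := i.baseSet
  isOpen_baseSet i := i.isOpen
  indexAt p := (B.exists_frame p).choose
  mem_baseSet_at p := (B.exists_frame p).choose_spec
  coordChange := B.transition
  coordChange_self i p hp v := by
    ext b
    simp [transition_apply, B.coeff_self i _ _ hp]
  continuousOn_coordChange i j := (B.contMDiffOn_transition i j).continuousOn
  coordChange_comp i j k p hp v := by
    ext c
    simp only [transition_apply, ← B.coeff_comp i j k _ c hp, Finset.mul_sum, Finset.sum_mul]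
    rw [Finset.sum_comm]
    simp only [mul_assoc]

instance : B.core.IsContMDiff (𝓡 n) ∞ where
  contMDiffOn_coordChange := B.contMDiffOn_transition

/-- The fibre at `p` of the `b`-tangent bundle. -/
abbrev BTangentSpace (p : M) : Type := B.core.Fiber p

/-- The total space of the `b`-tangent bundle, a smooth vector bundle over `M`. -/
abbrev BTangentBundle := TotalSpace (EuclideanSpace ℝ (Fin n)) B.BTangentSpace

/-- The anchor `ᵇT_pM → T_pM`, induced by the inclusion of vector fields tangent to `Z` into
all vector fields. -/
noncomputable def anchor (p : M) : B.BTangentSpace p →ₗ[ℝ] TangentSpace (𝓡 n) p where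
  toFun v := ∑ a, (show EuclideanSpace ℝ (Fin n) from v) a • (B.core.indexAt p).e a p
  map_add' v w := by
    rw [← Finset.sum_add_distrib]
    exact Finset.sum_congr rfl fun a _ => add_smul _ _ _
  map_smul' c v := by
    rw [Finset.smul_sum]
    exact Finset.sum_congr rfl fun a _ => mul_smul _ _ _


/-- In the trivialization given by a frame, the anchor sends the standard basis to the frame. -/
theorem anchor_eq (i : B.Frame) {p : M} (hp : p ∈ i.baseSet) (v : B.BTangentSpace p) :
    B.anchor p v = ∑ a, ((B.core.localTriv i) ⟨p, v⟩).2 a • i.e a p := by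
  have h2 : ∀ b, ((B.core.localTriv i) ⟨p, v⟩).2 b = ∑ a, (show EuclideanSpace ℝ (Fin n) from v) a *
      B.coeff (B.core.indexAt p) i a b p := B.transition_apply (B.core.indexAt p) i p v
  simp only [h2, Finset.sum_smul]
  rw [Finset.sum_comm]
  change ∑ a, (show EuclideanSpace ℝ (Fin n) from v) a • (B.core.indexAt p).e a p = _
  refine Finset.sum_congr rfl fun a _ => ?_
  rw [B.sum_coeff _ i a ⟨B.core.mem_baseSet_at p, hp⟩, Finset.smul_sum]
  simp only [smul_smul]

/-- `s` is smooth on the set `V`, as a section of the `b`-tangent bundle. -/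
def IsSmoothBSection (V : Set M) (s : Π p : M, B.BTangentSpace p) : Prop :=
  ContMDiffOn (𝓡 n) ((𝓡 n).prod 𝓘(ℝ, EuclideanSpace ℝ (Fin n))) ∞
    (fun p => (⟨p, s p⟩ : B.BTangentBundle)) V

theorem contMDiffOn_localTriv {V : Set M} {s : Π p : M, B.BTangentSpace p}
    (hs : B.IsSmoothBSection V s) (i : B.Frame) (a : Fin n) :
    ContMDiffOn (𝓡 n) 𝓘(ℝ) ∞ (fun p => ((B.core.localTriv i) ⟨p, s p⟩).2 a)
      (V ∩ i.baseSet) := by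
  have hi : MemTrivializationAtlas (B.core.localTriv i) := ⟨⟨i, rfl⟩⟩
  intro p hp
  have h1 := ((B.core.localTriv i).contMDiffWithinAt_section (IB := 𝓡 n) (n := ∞) (s := s)
    (V ∩ i.baseSet) hp.2).1 (hs.mono inter_subset_left p hp)
  exact (EuclideanSpace.proj a : EuclideanSpace ℝ (Fin n) →L[ℝ] ℝ).contMDiff.contMDiffAt.comp_contMDiffWithinAt p h1

theorem isBVectorField_anchor {V : Set M} (hV : IsOpen V) {s : Π p : M, B.BTangentSpace p}
    (hs : B.IsSmoothBSection V s) : B.IsBVectorField V (fun p => B.anchor p (s p)) := by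
  constructor
  · intro p hp
    let i := B.core.indexAt p
    have hpi : p ∈ i.baseSet := B.core.mem_baseSet_at p
    have hmem := (hV.inter i.isOpen).mem_nhds ⟨hp, hpi⟩
    have h1 : IsSmoothVF (V ∩ i.baseSet) (fun q =>
        ∑ a, ((B.core.localTriv i) ⟨q, s q⟩).2 a • i.e a q) :=
      .sum_section fun a _ => (B.contMDiffOn_localTriv hs i a).smul_section
        ((i.isBVectorField a).1.mono inter_subset_right)
    refine ContMDiffAt.contMDiffWithinAt ((h1.contMDiffAt hmem).congr_of_eventuallyEq ?_)
    filter_upwards [hmem] with q hq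
    rw [B.anchor_eq i hq.2]
  · intro p hp W g hW hpW hg hgZ
    change mvfderiv (𝓡 n) g p (∑ a, _ • (B.core.indexAt p).e a p) = 0
    rw [map_sum]
    refine Finset.sum_eq_zero fun a _ => ?_
    rw [map_smul, ((B.core.indexAt p).isBVectorField a).2 p ⟨B.core.mem_baseSet_at p, hp.2⟩ W g hW
      hpW hg hgZ, smul_zero]

theorem eq_of_anchor_eq {V : Set M} (hV : IsOpen V) {s s' : Π p : M, B.BTangentSpace p}
    (hs : B.IsSmoothBSection V s) (hs' : B.IsSmoothBSection V s')
    (h : ∀ p ∈ V, B.anchor p (s p) = B.anchor p (s' p)) : ∀ p ∈ V, s p = s' p := by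
  intro p hp
  let i := B.core.indexAt p
  have hpi : p ∈ i.baseSet := B.core.mem_baseSet_at p
  have key := i.independent (V ∩ i.baseSet) inter_subset_right (hV.inter i.isOpen)
    (fun a q => ((B.core.localTriv i) ⟨q, s q⟩).2 a - ((B.core.localTriv i) ⟨q, s' q⟩).2 a)
    (fun a => (B.contMDiffOn_localTriv hs i a).sub (B.contMDiffOn_localTriv hs' i a))
    (fun q hq => by
      simp only [sub_smul, Finset.sum_sub_distrib]
      rw [← B.anchor_eq i hq.2, ← B.anchor_eq i hq.2, h q hq.1, sub_self])
  have h2 : ((B.core.localTriv i) ⟨p, s p⟩).2 = ((B.core.localTriv i) ⟨p, s' p⟩).2 := by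
    ext a
    exact sub_eq_zero.1 (key a p ⟨hp, hpi⟩)
  have h3 : ∀ v : B.BTangentSpace p, ((B.core.localTriv i) ⟨p, v⟩).2 = v := fun v =>
    B.core.coordChange_self i p hpi v
  rwa [h3, h3] at h2

theorem exists_lift {V : Set M} (hV : IsOpen V) {X : Π p : M, TangentSpace (𝓡 n) p}
    (hX : B.IsBVectorField V X) :
    ∃ s : Π p : M, B.BTangentSpace p, B.IsSmoothBSection V s ∧
      ∀ p ∈ V, B.anchor p (s p) = X p := by
  have hgen : ∀ i : B.Frame, ∃ c : Fin n → M → ℝ,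
      (∀ a, ContMDiffOn (𝓡 n) 𝓘(ℝ) ∞ (c a) (V ∩ i.baseSet)) ∧
      ∀ p ∈ V ∩ i.baseSet, X p = ∑ a, c a p • i.e a p := fun i =>
    i.generates _ inter_subset_right (hV.inter i.isOpen) X
      ⟨hX.1.mono inter_subset_left, fun p hp => hX.2 p ⟨hp.1.1, hp.2⟩⟩
  choose c hc hcX using hgen
  let s : Π p : M, B.BTangentSpace p := fun p =>
    (WithLp.toLp 2 (fun a => c (B.core.indexAt p) a p) : EuclideanSpace ℝ (Fin n))
  have hcoord : ∀ (i : B.Frame) (p : M), p ∈ V ∩ i.baseSet → ∀ b,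
      ((B.core.localTriv i) ⟨p, s p⟩).2 b = c i b p := by
    intro i p hp b
    have h1 : ((B.core.localTriv i) ⟨p, s p⟩).2 b = ∑ a, c (B.core.indexAt p) a p *
      B.coeff (B.core.indexAt p) i a b p := B.transition_apply (B.core.indexAt p) i p _ b
    rw [h1]
    set j := B.core.indexAt p with hj
    have hpj : p ∈ j.baseSet := B.core.mem_baseSet_at p
    rw [← sub_eq_zero]
    refine i.independent (V ∩ j.baseSet ∩ i.baseSet) inter_subset_right
      ((hV.inter j.isOpen).inter i.isOpen)
      (fun b q => ∑ a, c j a q * B.coeff j i a b q - c i b q) (fun b => ?_) (fun q hq => ?_) b p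
      ⟨⟨hp.1, hpj⟩, hp.2⟩
    · refine ContMDiffOn.sub (contMDiffOn_finsetSum fun a _ => ?_) ?_
      · exact ((hc j a).mono inter_subset_left).mul
          ((B.contMDiffOn_coeff j i a b).mono fun q hq => ⟨hq.1.2, hq.2⟩)
      · exact (hc i b).mono fun q hq => ⟨hq.1.1, hq.2⟩
    · simp only [sub_smul, Finset.sum_sub_distrib, Finset.sum_smul]
      rw [← hcX i q ⟨hq.1.1, hq.2⟩, Finset.sum_comm, sub_eq_zero, hcX j q hq.1]
      refine Finset.sum_congr rfl fun a _ => ?_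
      rw [B.sum_coeff j i a ⟨hq.1.2, hq.2⟩, Finset.smul_sum]
      simp only [smul_smul]
  refine ⟨s, fun p hp => ?_, fun p hp => ?_⟩
  · let i := B.core.indexAt p
    have hpi : p ∈ i.baseSet := B.core.mem_baseSet_at p
    have hi : MemTrivializationAtlas (B.core.localTriv i) := ⟨⟨i, rfl⟩⟩
    have hmem := (hV.inter i.isOpen).mem_nhds ⟨hp, hpi⟩
    refine ContMDiffAt.contMDiffWithinAt ?_
    refine ((B.core.localTriv i).contMDiffAt_section_iff (IB := 𝓡 n) (n := ∞) (s := s) hpi).2 ?_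
    have h2 : ContMDiffOn (𝓡 n) 𝓘(ℝ, EuclideanSpace ℝ (Fin n)) ∞
        (fun q => (WithLp.toLp 2 (fun a => c i a q) : EuclideanSpace ℝ (Fin n)))
        (V ∩ i.baseSet) := by
      have h3 : ContMDiffOn (𝓡 n) 𝓘(ℝ, Fin n → ℝ) ∞ (fun q a => c i a q) (V ∩ i.baseSet) :=
        contMDiffOn_pi_space.2 (hc i)
      exact ((EuclideanSpace.equiv (Fin n) ℝ).symm : (Fin n → ℝ) →L[ℝ]
        EuclideanSpace ℝ (Fin n)).contMDiff.comp_contMDiffOn h3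
    refine (h2.contMDiffAt hmem).congr_of_eventuallyEq ?_
    filter_upwards [hmem] with q hq
    ext a
    exact hcoord i q hq a
  · have hpi := B.core.mem_baseSet_at p
    rw [B.anchor_eq (B.core.indexAt p) hpi, hcX (B.core.indexAt p) p ⟨hp, hpi⟩]
    exact Finset.sum_congr rfl fun a _ => by rw [hcoord _ p ⟨hp, hpi⟩]

/-- The anchor identifies the smooth sections of the `b`-tangent bundle over an open set with the
smooth vector fields tangent to `Z`. -/
theorem sections_bTangent {V : Set M} (hV : IsOpen V) :
    (∀ s, B.IsSmoothBSection V s → B.IsBVectorField V (fun p => B.anchor p (s p))) ∧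
    (∀ X, B.IsBVectorField V X →
      ∃ s, B.IsSmoothBSection V s ∧ ∀ p ∈ V, B.anchor p (s p) = X p) ∧
    ∀ s s', B.IsSmoothBSection V s → B.IsSmoothBSection V s' →
      (∀ p ∈ V, B.anchor p (s p) = B.anchor p (s' p)) → ∀ p ∈ V, s p = s' p :=
  ⟨fun _ => B.isBVectorField_anchor hV, fun _ => B.exists_lift hV,
    fun _ _ => B.eq_of_anchor_eq hV⟩

/-- An isomorphism of smooth vector bundles (over the identity of `M`) from the tangent bundle to
the `b`-tangent bundle. -/
structure TangentIso where
  toEquiv : ∀ p : M, TangentSpace (𝓡 n) p ≃ₗ[ℝ] B.BTangentSpace p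
  contMDiff : ContMDiff (𝓡 n).tangent ((𝓡 n).prod 𝓘(ℝ, EuclideanSpace ℝ (Fin n))) ∞
    (fun v : TangentBundle (𝓡 n) M => (⟨v.1, toEquiv v.1 v.2⟩ : B.BTangentBundle))
  contMDiff_symm : ContMDiff ((𝓡 n).prod 𝓘(ℝ, EuclideanSpace ℝ (Fin n))) (𝓡 n).tangent ∞
    (fun v : B.BTangentBundle => (⟨v.1, (toEquiv v.1).symm v.2⟩ : TangentBundle (𝓡 n) M))

/-- Over a point `p ∉ Z`, where the anchor identifies `ᵇT_pM` with `T_pM`, an isomorphism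
`TM → ᵇTM` becomes an endomorphism of `T_pM`, the local gauge transformation. -/
noncomputable def TangentIso.gauge {B : BManifold n M} (Φ : B.TangentIso) (p : M) :
    TangentSpace (𝓡 n) p →ₗ[ℝ] TangentSpace (𝓡 n) p :=
  B.anchor p ∘ₗ (Φ.toEquiv p).toLinearMap

/-- The connected components of `M ∖ Z`. -/
abbrev Node : Type _ := ConnectedComponents ↥(B.Zᶜ)

/-- The connected components of `Z`. -/
abbrev Edge : Type _ := ConnectedComponents ↥B.Z

/-- A connected component of `M ∖ Z`, as a subset of `M`. -/
def nodeSet (a : B.Node) : Set M := Subtype.val '' {p : ↥(B.Zᶜ) | ConnectedComponents.mk p = a}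

/-- A connected component of `Z`, as a subset of `M`. -/
def edgeSet (e : B.Edge) : Set M := Subtype.val '' {p : ↥B.Z | ConnectedComponents.mk p = e}

/-- The nodes contained in the edge `e`: the components of `M ∖ Z` whose closure meets `e`. -/
def incident (e : B.Edge) : Set B.Node := {a | (closure (B.nodeSet a) ∩ B.edgeSet e).Nonempty}

/-- The associated graph of `(M, Z)`, a multigraph. A component `e` of `Z` has ends `a` and `b` if
these are precisely the nodes it contains; it is a loop if it contains a single node. -/
def associatedGraph : Graph B.Node B.Edge where
  vertexSet := univ
  IsLink e a b := B.incident e = {a, b}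
  isLink_symm := fun e _ => ⟨fun a b h => by rw [h, pair_comm]⟩
  eq_or_eq_of_isLink_of_isLink := fun e a b c d h h' => by
    have : a ∈ ({c, d} : Set B.Node) := by rw [← h', h]; exact mem_insert _ _
    simpa using this
  left_mem_of_isLink := fun _ _ _ _ => mem_univ _

end BManifold
end BManifold

/-- A two-coloring of a multigraph: the two ends of every edge have different colors. In particular
a graph with a loop has none. -/
def Graph.IsTwoColoring {α β : Type*} (G : Graph α β) (c : α → ℤˣ) : Prop :=
  ∀ ⦃e a b⦄, G.IsLink e a b → c a ≠ c b

/-- A multigraph is two-colorable if it has a two-coloring. -/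
def Graph.TwoColorable {α β : Type*} (G : Graph α β) : Prop :=
  ∃ c : α → ℤˣ, G.IsTwoColoring c

/-! Composed with the anchor, an isomorphism `Φ` becomes an endomorphism field `Φ.gauge` of the
tangent bundle that maps the smooth vector fields over an open set onto those tangent to `Z`. The
proof rests on one fact about its determinant `g`: near each point of `Z` it equals `f` times a
function without zeros, where `f` is the defining function. So `g` is nonzero off `Z` and changes
sign across `Z`.

This fact comes from two divisibilities. The function `g` vanishes on `Z`, since there the image of
the gauge transformation lies in the kernel of `df`; so `f` divides `g` by `exists_div`. Conversely,
any endomorphism field `L` that makes the coordinate fields tangent to `Z` factors smoothly through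
the gauge transformation, so `g` divides `det L` (`exists_det_gauge_mul`); a suitable transvection
has determinant exactly `f` (`exists_endomorphism_det_eq`). The two quotients are inverse to each
other off `Z`, and density of the complement together with continuity gives nonvanishing on `Z`
(`det_gauge_eq_mul`).

The graph enters through local topology. In a chart with first coordinate `f`, a small ball minus
`Z` has exactly two sides, each convex and hence inside a single node. These two nodes depend
locally constantly on the point of `Z`, so they are the same along a whole edge and are precisely
its ends (`exists_incident_eq`). The sign of `g` is constant on nodes and opposite on the two sides,
so it is a two-coloring; in particular the two sides never belong to the same node. -/

/-! ### Coordinate frames and smoothness of determinants. -/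

section TangentFrame

variable {n : ℕ} {M : Type*} [TopologicalSpace M] [ChartedSpace (EuclideanSpace ℝ (Fin n)) M]
  [IsManifold (𝓡 n) ∞ M]

/-- The coordinate frame of the tangent bundle in the standard trivialization at `q`. -/
noncomputable def coordFrame (q : M) (i : Fin n) (p : M) : TangentSpace (𝓡 n) p :=
  (trivializationAt (EuclideanSpace ℝ (Fin n)) (TangentSpace (𝓡 n)) q).localFrame
    (EuclideanSpace.basisFun (Fin n) ℝ).toBasis i p

/-- The domain of the standard trivialization of the tangent bundle at `q`. -/
def coordDomain (q : M) : Set M :=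
  (trivializationAt (EuclideanSpace ℝ (Fin n)) (TangentSpace (𝓡 n) (M := M)) q).baseSet

theorem isOpen_coordDomain (q : M) : IsOpen (coordDomain (n := n) q) :=
  (trivializationAt (EuclideanSpace ℝ (Fin n)) (TangentSpace (𝓡 n)) q).open_baseSet

theorem mem_coordDomain (q : M) : q ∈ coordDomain (n := n) q :=
  mem_baseSet_trivializationAt _ _ q

theorem isSmoothVF_coordFrame (q : M) (i : Fin n) :
    IsSmoothVF (coordDomain (n := n) q) (coordFrame q i) :=
  ((trivializationAt (EuclideanSpace ℝ (Fin n))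
    (TangentSpace (𝓡 n)) q).isLocalFrameOn_localFrame_baseSet (𝓡 n) ∞
    (EuclideanSpace.basisFun (Fin n) ℝ).toBasis).contMDiffOn i

/-- The basis of `T_pM` given by the coordinate frame at `q`. -/
theorem exists_basis_coordFrame {q p : M} (hp : p ∈ coordDomain (n := n) q) :
    ∃ b : Module.Basis (Fin n) ℝ (TangentSpace (𝓡 n) p), ∀ i, b i = coordFrame q i p := by
  have h := (trivializationAt (EuclideanSpace ℝ (Fin n))
    (TangentSpace (𝓡 n)) q).isLocalFrameOn_localFrame_baseSet (𝓡 n) ∞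
      (EuclideanSpace.basisFun (Fin n) ℝ).toBasis
  exact ⟨h.toBasisAt hp, fun i => by simp [coordFrame]⟩

/-- The determinant of an endomorphism of the tangent bundle is smooth if the endomorphism sends
the fields of a coordinate frame to smooth vector fields. -/
theorem contMDiffOn_det {q : M} {V : Set M} (hV : IsOpen V) (hVq : V ⊆ coordDomain (n := n) q)
    (G : ∀ p : M, TangentSpace (𝓡 n) p →ₗ[ℝ] TangentSpace (𝓡 n) p)
    (hG : ∀ i, IsSmoothVF V (fun p => G p (coordFrame q i p))) :
    ContMDiffOn (𝓡 n) 𝓘(ℝ) ∞ (fun p => LinearMap.det (G p)) V := by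
  let t := trivializationAt (EuclideanSpace ℝ (Fin n)) (TangentSpace (𝓡 n) (M := M)) q
  let b := (EuclideanSpace.basisFun (Fin n) ℝ).toBasis
  have hc : ∀ i j, ContMDiffOn (𝓡 n) 𝓘(ℝ) ∞
      (fun p => t.localFrameCoeff (𝓡 n) b i p (G p (coordFrame q j p))) V := fun i j =>
    (contMDiffOn_iff_localFrameCoeff (e := t) (k := ∞) b hV hVq).1 (hG j) i
  -- The Leibniz formula exhibits the determinant as a polynomial in the smooth frame coefficients.
  have hdet : ContMDiffOn (𝓡 n) 𝓘(ℝ) ∞ (fun p => Matrix.det (Matrix.of fun i j =>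
      t.localFrameCoeff (𝓡 n) b i p (G p (coordFrame q j p)))) V := by
    simp only [Matrix.det_apply', Matrix.of_apply]
    exact contMDiffOn_finsetSum fun σ _ =>
      contMDiffOn_const.mul (contMDiffOn_finsetProd fun i _ => hc (σ i) i)
  refine hdet.congr fun p hp => ?_
  obtain ⟨b', hb'⟩ := exists_basis_coordFrame (hVq hp)
  rw [← LinearMap.det_toMatrix b']
  congr 1
  ext i j
  rw [LinearMap.toMatrix_apply, Matrix.of_apply, hb']
  have h1 := t.eq_sum_localFrameCoeff_smul (b := b) (I := 𝓡 n)
    (s := fun p => G p (coordFrame q j p)) (hVq hp)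
  have h2 : G p (coordFrame q j p) = ∑ i, t.localFrameCoeff (𝓡 n) b i p
      (G p (coordFrame q j p)) • b' i := by
    simp only [hb']
    exact h1
  conv_lhs => rw [h2]
  exact congrFun (b'.repr_sum_self _) i

end TangentFrame

namespace BManifold

variable {n : ℕ} {M : Type*} [TopologicalSpace M] [ChartedSpace (EuclideanSpace ℝ (Fin n)) M]
  [IsManifold (𝓡 n) ∞ M] {B : BManifold n M}

/-! ### The determinant of the gauge transformation and its simple vanishing along `Z`. -/

section Gauge

/-- The gauge transformation sends smooth vector fields to smooth vector fields tangent to `Z`. -/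
theorem TangentIso.isBVectorField_gauge (Φ : B.TangentIso) {V : Set M} (hV : IsOpen V)
    {X : Π p : M, TangentSpace (𝓡 n) p} (hX : IsSmoothVF V X) :
    B.IsBVectorField V (fun p => Φ.gauge p (X p)) :=
  B.isBVectorField_anchor (s := fun p => Φ.toEquiv p (X p)) hV (Φ.contMDiff.comp_contMDiffOn hX)

/-- Every smooth vector field tangent to `Z` is the image of a smooth vector field under the gauge
transformation. -/
theorem TangentIso.exists_gauge_eq (Φ : B.TangentIso) {V : Set M} (hV : IsOpen V)
    {X : Π p : M, TangentSpace (𝓡 n) p} (hX : B.IsBVectorField V X) :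
    ∃ Y : Π p : M, TangentSpace (𝓡 n) p, IsSmoothVF V Y ∧ ∀ p ∈ V, Φ.gauge p (Y p) = X p := by
  obtain ⟨s, hs, hsX⟩ := B.exists_lift hV hX
  -- Here the smoothness of the inverse of `Φ` is needed: it is applied to the section that lifts
  -- `X` through the anchor.
  refine ⟨fun p => (Φ.toEquiv p).symm (s p), Φ.contMDiff_symm.comp_contMDiffOn hs, fun p hp => ?_⟩
  simp [TangentIso.gauge, hsX p hp]

theorem TangentIso.contMDiffOn_det_gauge (Φ : B.TangentIso) (q : M) :
    ContMDiffOn (𝓡 n) 𝓘(ℝ) ∞ (fun p => LinearMap.det (Φ.gauge p)) (coordDomain (n := n) q) :=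
  contMDiffOn_det (isOpen_coordDomain q) subset_rfl _ fun i =>
    (Φ.isBVectorField_gauge (isOpen_coordDomain q) (isSmoothVF_coordFrame q i)).1

/-- If an endomorphism `L` sends the coordinate fields to smooth vector fields tangent to `Z`, then
the determinant of the gauge transformation divides the determinant of `L`. -/
theorem TangentIso.exists_det_gauge_mul (Φ : B.TangentIso) {q : M} {V : Set M} (hV : IsOpen V)
    (hVq : V ⊆ coordDomain (n := n) q)
    (L : ∀ p : M, TangentSpace (𝓡 n) p →ₗ[ℝ] TangentSpace (𝓡 n) p)
    (hL : ∀ i, B.IsBVectorField V (fun p => L p (coordFrame q i p))) :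
    ∃ y : M → ℝ, ContMDiffOn (𝓡 n) 𝓘(ℝ) ∞ y V ∧
      ∀ p ∈ V, LinearMap.det (Φ.gauge p) * y p = LinearMap.det (L p) := by
  choose Y hY hYL using fun i => Φ.exists_gauge_eq hV (hL i)
  -- `T` is the other factor in `L = Φ.gauge ∘ T` over `V`, prescribed on the coordinate frame by
  -- the preimages `Y i`. The quotient is its determinant; the value `0` outside `V` plays no role.
  have hT : ∀ p, ∃ T : TangentSpace (𝓡 n) p →ₗ[ℝ] TangentSpace (𝓡 n) p,
      p ∈ V → ∀ i, T (coordFrame q i p) = Y i p := by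
    intro p
    by_cases hp : p ∈ V
    · obtain ⟨b, hb⟩ := exists_basis_coordFrame (hVq hp)
      exact ⟨b.constr ℝ fun i => Y i p, fun _ i => by rw [← hb, b.constr_basis]⟩
    · exact ⟨0, fun h => absurd h hp⟩
  choose T hT using hT
  refine ⟨fun p => LinearMap.det (T p), contMDiffOn_det hV hVq T fun i =>
    (hY i).congr fun p hp => by simp only [hT p hp i], fun p hp => ?_⟩
  rw [← LinearMap.det_comp]
  congr 1
  obtain ⟨b, hb⟩ := exists_basis_coordFrame (hVq hp)
  refine b.ext fun i => ?_
  rw [hb, LinearMap.comp_apply, hT p hp, hYL i p hp]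

/-- Away from `Z` tangency is a vacuous condition, so the identity itself factors through the gauge
transformation and the determinant divides `1`. -/
theorem TangentIso.det_gauge_ne_zero (Φ : B.TangentIso) {p : M} (hp : p ∉ B.Z) :
    LinearMap.det (Φ.gauge p) ≠ 0 := by
  obtain ⟨y, -, hy⟩ := Φ.exists_det_gauge_mul (q := p)
    ((isOpen_coordDomain p).inter B.isClosed.isOpen_compl) inter_subset_left
    (fun _ => LinearMap.id) fun i => ⟨(isSmoothVF_coordFrame p i).mono inter_subset_left,
      fun x hx => absurd hx.2 hx.1.2⟩
  intro h
  have := hy p ⟨mem_coordDomain p, hp⟩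
  rw [h, zero_mul, LinearMap.det_id] at this
  exact zero_ne_one this

/-- At a point of `Z` the image consists of vectors tangent to `Z` and so lies in the kernel of
`df`, which is a proper subspace. A nonzero determinant would make the map surjective and force `df
= 0`. -/
theorem TangentIso.det_gauge_eq_zero (Φ : B.TangentIso) {p : M} (hp : p ∈ B.Z) :
    LinearMap.det (Φ.gauge p) = 0 := by
  obtain ⟨U, f, hU, hZU, hf, hfZ, hdf⟩ := B.exists_defining
  obtain ⟨b, hb⟩ := exists_basis_coordFrame (mem_coordDomain (n := n) p)
  by_contra hne
  apply hdf p hp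
  let F : TangentSpace (𝓡 n) p →ₗ[ℝ] ℝ := (mvfderiv (𝓡 n) f p).toLinearMap
  have hF : F ∘ₗ Φ.gauge p = 0 := b.ext fun i => by
    rw [hb]
    exact (Φ.isBVectorField_gauge (isOpen_coordDomain p) (isSmoothVF_coordFrame p i)).2 p
      ⟨mem_coordDomain p, hp⟩ U f hU (hZU hp) hf fun x hx => (hfZ x hx.1).2 hx.2
  have hsurj : Function.Surjective (Φ.gauge p) :=
    have : FiniteDimensional ℝ (TangentSpace (𝓡 n) p) := b.finiteDimensional_of_finite
    (LinearMap.equivOfDetNeZero _ hne).surjective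
  ext v
  obtain ⟨w, rfl⟩ := hsurj v
  exact LinearMap.congr_fun hF w

/-- Near a point of `Z`, there is an endomorphism of the tangent bundle whose image is tangent to
`Z`, and whose determinant is the defining function. -/
theorem exists_endomorphism_det_eq {U : Set M} {f : M → ℝ} (hU : IsOpen U)
    (hf : ContMDiffOn (𝓡 n) 𝓘(ℝ) ∞ f U) (hfZ : ∀ q ∈ U, f q = 0 ↔ q ∈ B.Z)
    (hdf : ∀ q ∈ B.Z, mvfderiv (𝓡 n) f q ≠ 0) {q : M} (hqU : q ∈ U) (hq : q ∈ B.Z) :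
    ∃ (V : Set M) (L : ∀ p : M, TangentSpace (𝓡 n) p →ₗ[ℝ] TangentSpace (𝓡 n) p),
      IsOpen V ∧ q ∈ V ∧ V ⊆ U ∧ V ⊆ coordDomain (n := n) q ∧
      (∀ i, B.IsBVectorField V (fun p => L p (coordFrame q i p))) ∧
      ∀ p ∈ V, LinearMap.det (L p) = f p := by
  let a : Fin n → M → ℝ := fun i p => mvfderiv (𝓡 n) f p (coordFrame q i p)
  have hDU : IsOpen (coordDomain (n := n) q ∩ U) := (isOpen_coordDomain q).inter hU
  have ha : ∀ i, ContMDiffOn (𝓡 n) 𝓘(ℝ) ∞ (a i) (coordDomain (n := n) q ∩ U) := fun i =>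
    contMDiffOn_mvfderiv_apply hDU (hf.mono inter_subset_right)
      ((isSmoothVF_coordFrame q i).mono inter_subset_left)
  obtain ⟨k, hk⟩ : ∃ k, a k q ≠ 0 := by
    by_contra! hcon
    obtain ⟨b, hb⟩ := exists_basis_coordFrame (mem_coordDomain (n := n) q)
    let F : TangentSpace (𝓡 n) q →ₗ[ℝ] ℝ := (mvfderiv (𝓡 n) f q).toLinearMap
    have hF : F = 0 := b.ext fun i => by rw [hb]; exact hcon i
    apply hdf q hq
    ext v
    exact LinearMap.congr_fun hF v
  let V : Set M := (coordDomain (n := n) q ∩ U) ∩ a k ⁻¹' {0}ᶜ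
  have hV : IsOpen V := (ha k).continuousOn.isOpen_inter_preimage hDU isOpen_compl_singleton
  have hak : ∀ p ∈ V, a k p ≠ 0 := fun p hp => hp.2
  have hVU : V ⊆ U := fun p hp => hp.1.2
  have hVD : V ⊆ coordDomain (n := n) q := fun p hp => hp.1.1
  let w : Π p : M, TangentSpace (𝓡 n) p := fun p => (a k p)⁻¹ • coordFrame q k p
  have hw : IsSmoothVF V w :=
    (((ha k).mono inter_subset_left).inv₀ hak).smul_section ((isSmoothVF_coordFrame q k).mono hVD)
  have hdw : ∀ p ∈ V, mvfderiv (𝓡 n) f p (w p) = 1 := fun p hp => by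
    rw [map_smul, smul_eq_mul]
    exact inv_mul_cancel₀ (hak p hp)
  -- The map is `v ↦ v + (f - 1) df(v) w` with `df(w) = 1`: it multiplies the `df`-component by `f`.
  -- Hence `df(L v) = f df(v)`, which vanishes on `Z`, and `det L = 1 + (f - 1) df(w) = f`.
  refine ⟨V, fun p => LinearMap.transvection
    ((f p - 1) • (mvfderiv (𝓡 n) f p).toLinearMap) (w p), hV, ⟨⟨mem_coordDomain q, hqU⟩, hk⟩,
    hVU, hVD, fun i => ⟨?_, fun p hp => ?_⟩, fun p hp => ?_⟩
  · have h1 : ContMDiffOn (𝓡 n) 𝓘(ℝ) ∞ (fun p => (f p - 1) * a i p) V :=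
      ((hf.mono hVU).sub contMDiffOn_const).mul ((ha i).mono inter_subset_left)
    exact ((isSmoothVF_coordFrame q i).mono hVD).add_section (h1.smul_section hw)
  · refine B.isTangentTo_of_mvfderiv_eq_zero hU hf hfZ hdf (hVU hp.1) hp.2 ?_
    have h1 : LinearMap.transvection ((f p - 1) • (mvfderiv (𝓡 n) f p).toLinearMap) (w p)
        (coordFrame q i p) = coordFrame q i p + ((f p - 1) * a i p) • w p := rfl
    beta_reduce
    rw [h1, map_add, map_smul, hdw p hp.1, (hfZ p (hVU hp.1)).2 hp.2]
    simp [a]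
  · have : Module.Finite ℝ (TangentSpace (𝓡 n) p) :=
      inferInstanceAs (Module.Finite ℝ (EuclideanSpace ℝ (Fin n)))
    have : Module.Free ℝ (TangentSpace (𝓡 n) p) :=
      inferInstanceAs (Module.Free ℝ (EuclideanSpace ℝ (Fin n)))
    rw [LinearMap.transvection.det]
    change 1 + (f p - 1) * mvfderiv (𝓡 n) f p (w p) = f p
    rw [hdw p hp]
    ring

/-- Near a point of `Z`, the determinant of the gauge transformation is the product of the defining
function with a function that has no zeros. -/
theorem TangentIso.det_gauge_eq_mul (Φ : B.TangentIso) {U : Set M} {f : M → ℝ} (hU : IsOpen U)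
    (hf : ContMDiffOn (𝓡 n) 𝓘(ℝ) ∞ f U) (hfZ : ∀ q ∈ U, f q = 0 ↔ q ∈ B.Z)
    (hdf : ∀ q ∈ B.Z, mvfderiv (𝓡 n) f q ≠ 0) {q : M} (hqU : q ∈ U) (hq : q ∈ B.Z) :
    ∃ h : M → ℝ, ContinuousAt h q ∧ h q ≠ 0 ∧
      ∀ᶠ p in 𝓝 q, LinearMap.det (Φ.gauge p) = f p * h p := by
  obtain ⟨V, L, hV, hqV, hVU, hVD, hL, hdet⟩ := exists_endomorphism_det_eq hU hf hfZ hdf hqU hq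
  obtain ⟨y, hy, hyL⟩ := Φ.exists_det_gauge_mul hV hVD L hL
  obtain ⟨h, hh, heq⟩ := B.exists_div hf hfZ hdf hV hVU ((Φ.contMDiffOn_det_gauge q).mono hVD)
    fun p hp => Φ.det_gauge_eq_zero hp.2
  have hVn := hV.mem_nhds hqV
  have hhq := hh.continuousOn.continuousAt hVn
  refine ⟨h, hhq, fun h0 => ?_, by filter_upwards [hVn] with p hp using heq p hp⟩
  -- With `g = f h` and `g y = f`, cancelling `f` gives `h y = 1` off `Z`. If `h q = 0`, then `h y ≠
  -- 1` near `q` by continuity, although points off `Z` occur arbitrarily close to `q`.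
  have hhy : ContinuousAt (fun p => h p * y p) q := hhq.mul (hy.continuousOn.continuousAt hVn)
  have hev : ∀ᶠ p in 𝓝 q, h p * y p ≠ 1 ∧ p ∈ V :=
    (hhy.eventually_ne (by simp [h0])).and hVn
  obtain ⟨p, hpZ, hp1, hpV⟩ := B.dense_compl.inter_nhds_nonempty hev
  have hfp : f p ≠ 0 := fun h => hpZ ((hfZ p (hVU hpV)).1 h)
  have h1 := hyL p hpV
  rw [hdet p hpV, heq p hpV, mul_assoc] at h1
  exact hp1 (mul_left_cancel₀ hfp (by rw [h1, mul_one]))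

end Gauge

/-! ### The two local sides of `Z` and the ends of an edge. -/

section Sides

/-- A smooth function is the first coordinate of a chart near a regular point. -/
theorem exists_openPartialHomeomorph_fst_eq {U : Set M} {f : M → ℝ} (hU : IsOpen U)
    (hf : ContMDiffOn (𝓡 n) 𝓘(ℝ) ∞ f U) {q : M} (hqU : q ∈ U) (hdf : mvfderiv (𝓡 n) f q ≠ 0) :
    ∃ (K : Submodule ℝ (EuclideanSpace ℝ (Fin n))) (e : OpenPartialHomeomorph M (ℝ × K)),
      q ∈ e.source ∧ ∀ p ∈ e.source, (e p).1 = f p := by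
  let φ := chartAt (EuclideanSpace ℝ (Fin n)) q
  have hmd : ContMDiffAt (𝓡 n) 𝓘(ℝ) ∞ f q := hf.contMDiffAt (hU.mem_nhds hqU)
  have hF : ContDiffAt ℝ ∞ (f ∘ φ.symm) (φ q) := by
    have h := (contMDiffAt_iff.1 hmd).2
    simpa [φ, chartAt_self_eq, contDiffWithinAt_univ, Function.comp_def] using h
  have hF' : fderiv ℝ (f ∘ φ.symm) (φ q) ≠ 0 := by
    intro hcon
    apply hdf
    rw [(hmd.mdifferentiableAt (by simp)).mvfderiv]
    simp only [writtenInExtChartAt, extChartAt_model_space_eq_id, PartialEquiv.refl_coe,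
      Function.id_comp]
    have : range (𝓡 n) = univ := by simp
    rw [this, fderivWithin_univ]
    exact hcon
  have hs := hF.hasStrictFDerivAt (by simp)
  have hrange : (fderiv ℝ (f ∘ φ.symm) (φ q)).range = ⊤ := by
    refine LinearMap.range_eq_top.2 (LinearMap.surjective ?_)
    exact fun h => hF' (ContinuousLinearMap.coe_injective h)
  -- The implicit function theorem supplies the chart; `K` is the kernel of the derivative of `f` in
  -- the coordinates `φ`.
  refine ⟨_, φ.trans (hs.implicitToOpenPartialHomeomorph _ _ hrange), ?_, fun p hp => ?_⟩
  · rw [OpenPartialHomeomorph.trans_source]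
    exact ⟨mem_chart_source _ q, hs.mem_implicitToOpenPartialHomeomorph_source hrange⟩
  · rw [OpenPartialHomeomorph.trans_source] at hp
    rw [OpenPartialHomeomorph.coe_trans, Function.comp_apply,
      HasStrictFDerivAt.implicitToOpenPartialHomeomorph_fst, Function.comp_apply,
      φ.left_inv hp.1]

/-- A regular zero has an open neighbourhood in which the two sides of the zero set are connected,
and both sides accumulate at the zero. -/
theorem exists_isPreconnected_sides {U : Set M} {f : M → ℝ} (hU : IsOpen U)
    (hf : ContMDiffOn (𝓡 n) 𝓘(ℝ) ∞ f U) {q : M} (hqU : q ∈ U) (hdf : mvfderiv (𝓡 n) f q ≠ 0)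
    (hfq : f q = 0) :
    ∃ W : Set M, IsOpen W ∧ q ∈ W ∧ W ⊆ U ∧
      IsPreconnected (W ∩ {p | 0 < f p}) ∧ IsPreconnected (W ∩ {p | f p < 0}) ∧
      q ∈ closure {p | 0 < f p} ∧ q ∈ closure {p | f p < 0} := by
  obtain ⟨K, e, hqe, he⟩ := exists_openPartialHomeomorph_fst_eq hU hf hqU hdf
  have hopen : IsOpen (e.target ∩ e.symm ⁻¹' U) := e.symm.isOpen_inter_preimage hU
  obtain ⟨r, hr, hball⟩ := Metric.isOpen_iff.1 hopen (e q)
    ⟨e.map_source hqe, by simpa [e.left_inv hqe] using hqU⟩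
  have hsymm : ∀ y ∈ e.target, f (e.symm y) = y.1 := fun y hy => by
    rw [← he _ (e.map_target hy), e.right_inv hy]
  -- In the chart, the condition `f p ∈ I` restricts only the first coordinate, so the set is the
  -- image of a convex part of the ball. The half-lines `Ioi 0` and `Iio 0` give the two sides.
  have hside : ∀ I : Set ℝ, Convex ℝ I →
      IsPreconnected (e.source ∩ e ⁻¹' Metric.ball (e q) r ∩ {p | f p ∈ I}) := by
    intro I hI
    have hconv : Convex ℝ (Metric.ball (e q) r ∩ Prod.fst ⁻¹' I) :=
      (convex_ball _ _).inter (hI.linear_preimage (LinearMap.fst ℝ ℝ K))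
    have himg := hconv.isPreconnected.image e.symm
      (e.continuousOn_symm.mono fun y hy => (hball hy.1).1)
    convert himg using 1
    ext p
    constructor
    · rintro ⟨⟨hp1, hp2⟩, hp3⟩
      exact ⟨e p, ⟨hp2, by simpa [he p hp1] using hp3⟩, e.left_inv hp1⟩
    · rintro ⟨y, ⟨hy1, hy2⟩, rfl⟩
      have hy := (hball hy1).1
      refine ⟨⟨e.map_target hy, ?_⟩, ?_⟩
      · simpa [e.right_inv hy] using hy1
      · simpa [hsymm y hy] using hy2
  -- A transversal curve through `q` along which `f` is the parameter; its two halves approach `q`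
  -- from the two sides.
  have hcurve : Tendsto (fun s : ℝ => e.symm (s, (e q).2)) (𝓝 0) (𝓝 q) ∧
      ∀ᶠ s : ℝ in 𝓝 0, f (e.symm (s, (e q).2)) = s := by
    have h0 : ((0 : ℝ), (e q).2) = e q := Prod.ext (by rw [he q hqe, hfq]) rfl
    have h1 : Tendsto (fun s : ℝ => (s, (e q).2)) (𝓝 0) (𝓝 (e q)) := by
      have : Continuous fun s : ℝ => (s, (e q).2) := by fun_prop
      simpa only [h0] using this.tendsto 0
    refine ⟨(e.tendsto_symm hqe).comp h1, ?_⟩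
    filter_upwards [h1.eventually (e.open_target.mem_nhds (e.map_source hqe))] with s hs
    exact hsymm _ hs
  refine ⟨e.source ∩ e ⁻¹' Metric.ball (e q) r, e.isOpen_inter_preimage Metric.isOpen_ball,
    ⟨hqe, Metric.mem_ball_self hr⟩, fun p hp => ?_, hside (Ioi 0) (convex_Ioi 0),
    hside (Iio 0) (convex_Iio 0), ?_, ?_⟩
  · simpa [e.left_inv hp.1] using (hball hp.2).2
  · refine mem_closure_of_tendsto (b := 𝓝[>] (0 : ℝ)) (hcurve.1.mono_left nhdsWithin_le_nhds) ?_
    filter_upwards [self_mem_nhdsWithin, nhdsWithin_le_nhds hcurve.2] with s hs hs'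
    simpa [hs'] using hs
  · refine mem_closure_of_tendsto (b := 𝓝[<] (0 : ℝ)) (hcurve.1.mono_left nhdsWithin_le_nhds) ?_
    filter_upwards [self_mem_nhdsWithin, nhdsWithin_le_nhds hcurve.2] with s hs hs'
    simpa [hs'] using hs

theorem mem_nodeSet_iff {x : B.Node} {p : M} :
    p ∈ B.nodeSet x ↔ ∃ hp : p ∉ B.Z, ConnectedComponents.mk (⟨p, hp⟩ : ↥(B.Zᶜ)) = x := by
  simp [nodeSet]

theorem eq_of_mem_nodeSet {x y : B.Node} {p : M} (hx : p ∈ B.nodeSet x) (hy : p ∈ B.nodeSet y) :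
    x = y := by
  obtain ⟨_, rfl⟩ := mem_nodeSet_iff.1 hx
  obtain ⟨_, rfl⟩ := mem_nodeSet_iff.1 hy
  rfl

/-- A nonempty connected set that does not meet `Z` lies in a node. -/
theorem exists_subset_nodeSet {S : Set M} (hS : IsPreconnected S) (hne : S.Nonempty)
    (hSZ : S ⊆ B.Zᶜ) : ∃ x : B.Node, S ⊆ B.nodeSet x := by
  obtain ⟨p, hp⟩ := hne
  refine ⟨ConnectedComponents.mk ⟨p, hSZ hp⟩, fun p' hp' => mem_nodeSet_iff.2 ⟨hSZ hp', ?_⟩⟩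
  have hS' : IsPreconnected ((↑) ⁻¹' S : Set ↥(B.Zᶜ)) := by
    rw [← IsInducing.subtypeVal.isPreconnected_image, Subtype.image_preimage_coe,
      inter_eq_right.2 hSZ]
    exact hS
  exact ConnectedComponents.coe_eq_coe'.2
    (hS'.subset_connectedComponent (x := ⟨p, hSZ hp⟩) hp hp')

/-- Near a point of `Z`, each of the two sides of `Z` lies in a node. -/
theorem exists_nodes_nhds {U : Set M} {f : M → ℝ} (hU : IsOpen U)
    (hf : ContMDiffOn (𝓡 n) 𝓘(ℝ) ∞ f U) (hfZ : ∀ q ∈ U, f q = 0 ↔ q ∈ B.Z)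
    (hdf : ∀ q ∈ B.Z, mvfderiv (𝓡 n) f q ≠ 0) {q : M} (hqU : q ∈ U) (hq : q ∈ B.Z) :
    ∃ a b : B.Node, (∀ᶠ p in 𝓝 q, 0 < f p → p ∈ B.nodeSet a) ∧
      (∀ᶠ p in 𝓝 q, f p < 0 → p ∈ B.nodeSet b) := by
  obtain ⟨W, hW, hqW, hWU, hpos, hneg, hcp, hcn⟩ :=
    exists_isPreconnected_sides hU hf hqU (hdf q hq) ((hfZ q hqU).2 hq)
  obtain ⟨a, ha⟩ := exists_subset_nodeSet (B := B) hpos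
    (mem_closure_iff.1 hcp W hW hqW) fun p hp hpZ => hp.2.ne' ((hfZ p (hWU hp.1)).2 hpZ)
  obtain ⟨b, hb⟩ := exists_subset_nodeSet (B := B) hneg
    (mem_closure_iff.1 hcn W hW hqW) fun p hp hpZ => hp.2.ne ((hfZ p (hWU hp.1)).2 hpZ)
  refine ⟨a, b, ?_, ?_⟩ <;> filter_upwards [hW.mem_nhds hqW] with p hp hfp
  · exact ha ⟨hp, hfp⟩
  · exact hb ⟨hp, hfp⟩

/-- A node that contains one side of `Z` near each point is constant along the components
of `Z`. -/
theorem eq_of_eventually_mem_nodeSet {S : Set M} (hS : ∀ q ∈ B.Z, q ∈ closure S)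
    {a : ↥B.Z → B.Node} (ha : ∀ q : ↥B.Z, ∀ᶠ p in 𝓝 (q : M), p ∈ S → p ∈ B.nodeSet (a q))
    {q q' : ↥B.Z} (h : ConnectedComponents.mk q = ConnectedComponents.mk q') : a q = a q' := by
  have hloc : IsLocallyConstant a := by
    rw [IsLocallyConstant.iff_eventually_eq]
    intro q
    -- For `q'` close to `q`, the defining property of `a q` also holds near `q'`. Since `S`
    -- accumulates at `q'`, some point of `S` lies in both `a q` and `a q'`, and distinct nodes are
    -- disjoint.
    have h1 := continuous_subtype_val.continuousAt.eventually (ha q).eventually_nhds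
    filter_upwards [h1] with q' hq'
    obtain ⟨p, ⟨h2, h3⟩, hp⟩ := mem_closure_iff_nhds.1 (hS q' q'.2) _ (inter_mem (ha q') hq')
    exact eq_of_mem_nodeSet (h2 hp) (h3 hp)
  exact hloc.apply_eq_of_isPreconnected isPreconnected_connectedComponent
    (ConnectedComponents.coe_eq_coe'.1 h) mem_connectedComponent

/-- The ends of an edge are the two nodes on the two sides of `Z` near any point of the edge. -/
theorem exists_incident_eq {U : Set M} {f : M → ℝ} (hU : IsOpen U) (hZU : B.Z ⊆ U)
    (hf : ContMDiffOn (𝓡 n) 𝓘(ℝ) ∞ f U) (hfZ : ∀ q ∈ U, f q = 0 ↔ q ∈ B.Z)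
    (hdf : ∀ q ∈ B.Z, mvfderiv (𝓡 n) f q ≠ 0) (e : B.Edge) :
    ∃ q ∈ B.Z, ∃ a b : B.Node, B.incident e = {a, b} ∧
      (∀ᶠ p in 𝓝 q, 0 < f p → p ∈ B.nodeSet a) ∧ (∀ᶠ p in 𝓝 q, f p < 0 → p ∈ B.nodeSet b) := by
  have hcl : ∀ q ∈ B.Z, q ∈ closure {p | 0 < f p} ∧ q ∈ closure {p | f p < 0} := fun q hq =>
    have ⟨_, _, _, _, _, _, h⟩ :=
      exists_isPreconnected_sides hU hf (hZU hq) (hdf q hq) ((hfZ q (hZU hq)).2 hq)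
    h
  choose a b ha hb using fun q : ↥B.Z => exists_nodes_nhds hU hf hfZ hdf (hZU q.2) q.2
  obtain ⟨q, rfl⟩ := ConnectedComponents.surjective_coe e
  have hmem : ∀ {S : Set M} {x : B.Node}, (q : M) ∈ closure S →
      (∀ᶠ p in 𝓝 (q : M), p ∈ S → p ∈ B.nodeSet x) → x ∈ B.incident (ConnectedComponents.mk q) := by
    intro S x hS hx
    refine ⟨q, mem_closure_iff_nhds.2 fun N hN => ?_, q, rfl, rfl⟩
    obtain ⟨p, ⟨hpN, hp⟩, hpS⟩ := mem_closure_iff_nhds.1 hS _ (inter_mem hN hx)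
    exact ⟨p, hpN, hp hpS⟩
  refine ⟨q, q.2, a q, b q, Subset.antisymm ?_ ?_, ha q, hb q⟩
  · rintro x ⟨_, hcx, q', hq', rfl⟩
    -- The closure of `x` may meet the edge at a point `q'` other than `q`. A point of `x` near `q'`
    -- lies on one of the two sides, which identifies `x` with `a q'` or `b q'`; constancy along the
    -- edge carries this back to `q`.
    obtain ⟨p, ⟨⟨hpa, hpb⟩, hpU⟩, hpx⟩ := mem_closure_iff_nhds.1 hcx _
      (inter_mem (inter_mem (ha q') (hb q')) (hU.mem_nhds (hZU q'.2)))
    obtain ⟨hpZ, -⟩ := mem_nodeSet_iff.1 hpx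
    rcases lt_trichotomy (f p) 0 with h | h | h
    · right
      rw [mem_singleton_iff, eq_of_mem_nodeSet hpx (hpb h)]
      exact eq_of_eventually_mem_nodeSet (fun q hq => (hcl q hq).2) hb hq'
    · exact absurd ((hfZ p hpU).1 h) hpZ
    · left
      rw [eq_of_mem_nodeSet hpx (hpa h)]
      exact eq_of_eventually_mem_nodeSet (fun q hq => (hcl q hq).1) ha hq'
  · rintro x (rfl | rfl)
    · exact hmem (hcl q q.2).1 (ha q)
    · exact hmem (hcl q q.2).2 (hb q)

end Sides

/-! ### The coloring by the sign of the determinant. -/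

section Coloring

/-- The sign of the determinant of the gauge transformation is constant on the nodes. -/
theorem TangentIso.exists_sign (Φ : B.TangentIso) : ∃ c : B.Node → ℤˣ, ∀ p : ↥(B.Zᶜ),
    ((c (ConnectedComponents.mk p) : ℤ) : ℝ) = Real.sign (LinearMap.det (Φ.gauge p)) := by
  classical
  -- The determinant has no zeros off `Z`, so the value `-1` means that it is negative, and `s` is
  -- locally constant.
  let s : ↥(B.Zᶜ) → ℤˣ := fun p => if 0 < LinearMap.det (Φ.gauge p) then 1 else -1
  have hs : Continuous s := by
    refine IsLocallyConstant.continuous ((IsLocallyConstant.iff_eventually_eq _).2 fun p => ?_)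
    have hcont : ContinuousAt (fun p : ↥(B.Zᶜ) => LinearMap.det (Φ.gauge p)) p :=
      ContinuousAt.comp (g := fun p : M => LinearMap.det (Φ.gauge p))
        ((Φ.contMDiffOn_det_gauge p).continuousOn.continuousAt
          ((isOpen_coordDomain _).mem_nhds (mem_coordDomain _))) continuous_subtype_val.continuousAt
    rcases (Φ.det_gauge_ne_zero p.2).lt_or_gt with h | h
    · filter_upwards [hcont.eventually_lt_const h] with y hy
      simp [s, hy.le.not_gt, h.le.not_gt]
    · filter_upwards [hcont.eventually_const_lt h] with y hy
      simp [s, hy, h]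
  refine ⟨hs.connectedComponentsLift, fun p => ?_⟩
  rw [hs.connectedComponentsLift_apply_coe]
  rcases (Φ.det_gauge_ne_zero p.2).lt_or_gt with h | h
  · simp [s, h.le.not_gt, Real.sign_of_neg h]
  · simp [s, h, Real.sign_of_pos h]

/-- The sign of the determinant of the gauge transformation changes across `Z`. -/
theorem TangentIso.isTwoColoring_of_sign (Φ : B.TangentIso) {c : B.Node → ℤˣ}
    (hc : ∀ p : ↥(B.Zᶜ),
      ((c (ConnectedComponents.mk p) : ℤ) : ℝ) = Real.sign (LinearMap.det (Φ.gauge p))) :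
    B.associatedGraph.IsTwoColoring c := by
  obtain ⟨U, f, hU, hZU, hf, hfZ, hdf⟩ := B.exists_defining
  have hcx : ∀ {x p}, p ∈ B.nodeSet x →
      ((c x : ℤ) : ℝ) = Real.sign (LinearMap.det (Φ.gauge p)) := by
    intro x p hp
    obtain ⟨hpZ, rfl⟩ := mem_nodeSet_iff.1 hp
    exact hc ⟨p, hpZ⟩
  intro e x y hxy
  obtain ⟨q, hq, a, b, hab, ha, hb⟩ := exists_incident_eq hU hZU hf hfZ hdf e
  obtain ⟨h, hcont, hne, hdet⟩ := Φ.det_gauge_eq_mul hU hf hfZ hdf (hZU hq) hq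
  obtain ⟨_, _, _, _, _, _, hcp, hcn⟩ :=
    exists_isPreconnected_sides hU hf (hZU hq) (hdf q hq) ((hfZ q (hZU hq)).2 hq)
  have hne' : c a ≠ c b := by
    intro hcab
    -- Near `q` the factor `h` keeps the sign of `h q`, so `f * h` takes opposite signs at a point
    -- `p` with `f p > 0` and a point `r` with `f r < 0`.
    have hsign : ∀ᶠ p in 𝓝 q, 0 < h q * h p :=
      (continuousAt_const.mul hcont).eventually_const_lt (mul_self_pos.2 hne)
    have hev := (ha.and hb).and (hdet.and hsign)
    obtain ⟨p, ⟨⟨hpa, -⟩, hp1, hp2⟩, hp⟩ := mem_closure_iff_nhds.1 hcp _ hev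
    obtain ⟨r, ⟨⟨-, hrb⟩, hr1, hr2⟩, hr⟩ := mem_closure_iff_nhds.1 hcn _ hev
    have h1 := hcx (hpa hp)
    have h2 := hcx (hrb hr)
    rw [hcab, h2, hp1, hr1] at h1
    simp only [mem_ofPred_eq] at hp hr
    rcases hne.lt_or_gt with hq0 | hq0
    · have hp0 := neg_of_mul_pos_right hp2 hq0.le
      have hr0 := neg_of_mul_pos_right hr2 hq0.le
      rw [Real.sign_of_pos (mul_pos_of_neg_of_neg hr hr0),
        Real.sign_of_neg (mul_neg_of_pos_of_neg hp hp0)] at h1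
      norm_num at h1
    · have hp0 := pos_of_mul_pos_right hp2 hq0.le
      have hr0 := pos_of_mul_pos_right hr2 hq0.le
      rw [Real.sign_of_neg (mul_neg_of_neg_of_pos hr hr0),
        Real.sign_of_pos (mul_pos hp hp0)] at h1
      norm_num at h1
  -- The ends are determined only as an unordered pair. A loop would give `a = b`, which `hne'`
  -- excludes.
  have hxy' : ({a, b} : Set B.Node) = {x, y} := hab.symm.trans hxy
  rcases pair_eq_pair_iff.1 hxy' with ⟨rfl, rfl⟩ | ⟨rfl, rfl⟩
  · exact hne'
  · exact hne'.symm

end Coloring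

end BManifold

theorem mainTheorem4 {n : ℕ} {M : Type*} [TopologicalSpace M] [T2Space M]
    [SecondCountableTopology M] [ChartedSpace (EuclideanSpace ℝ (Fin n)) M]
    [IsManifold (𝓡 n) ∞ M] (B : BManifold n M) :
    (∀ e : B.Edge, ∃ a b : B.Node, B.associatedGraph.IsLink e a b) ∧
    (Nonempty B.TangentIso → B.associatedGraph.TwoColorable) ∧
    ∀ Φ : B.TangentIso, ∃ c : B.Node → ℤˣ, B.associatedGraph.IsTwoColoring c ∧
      ∀ p : ↥(B.Zᶜ), ((c (ConnectedComponents.mk p) : ℤ) : ℝ) =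
        Real.sign (LinearMap.det (Φ.gauge p)) := by
  have hcol : ∀ Φ : B.TangentIso, ∃ c : B.Node → ℤˣ, B.associatedGraph.IsTwoColoring c ∧
      ∀ p : ↥(B.Zᶜ), ((c (ConnectedComponents.mk p) : ℤ) : ℝ) =
        Real.sign (LinearMap.det (Φ.gauge p)) := fun Φ =>
    have ⟨c, hc⟩ := Φ.exists_sign
    ⟨c, Φ.isTwoColoring_of_sign hc, hc⟩
  refine ⟨fun e => ?_, fun ⟨Φ⟩ => ?_, hcol⟩
  · obtain ⟨U, f, hU, hZU, hf, hfZ, hdf⟩ := B.exists_defining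
    obtain ⟨_, _, a, b, hab, -⟩ := BManifold.exists_incident_eq hU hZU hf hfZ hdf e
    exact ⟨a, b, hab⟩
  · obtain ⟨c, hc, -⟩ := hcol Φ
    exact ⟨c, hc⟩
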